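/- Fix countably infinite sets of concept names, role names and individual names. $\mathcal{ALCI}$-concepts are built from $\top$, $\bot$ and concept names with $\sqcap,\sqcup,\neg$, $\exists r.C$ and $\forall r.C$, where $r$ is a role name or the inverse of one; $\mathcal{ELI}$-concepts are those built only from $\top$, concept names, $\sqcap$ and $\exists r.C$. An $\mathcal{ALCFI}$-TBox $\mathcal T$ is a finite set of inclusions $C\sqsubseteq D$ between $\mathcal{ALCI}$-concepts and functionality assertions $\mathsf{func}(r)$, with the usual semantics; it has depth one if in its inclusions no restriction $\exists r.E$ or $\forall r.E$ lies in the scope of another restriction. An ABox $\mathcal A$ is a non-empty finite set of assertions $A(a)$ and $r(a,b)$ with $A$ a concept name, $r$ a role name and $a,b$ individual names; $\mathsf{Ind}(\mathcal A)$ is the set of individuals occurring in it. Models of $\mathcal A$ contain the individuals of $\mathcal A$ as (distinct) domain elements. An ELIQ is a query $C(x)$ with $C$ an $\mathcal{ELI}$-concept; a positive existential query (PEQ) is a first-order formula built from atoms $A(x)$, $r(x,y)$ with $\wedge,\vee,\exists$; a conjunctive query (CQ) is a PEQ without $\vee$. We write $\mathcal T,\mathcal A\models q(\vec a)$ if $\mathcal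 I\models q(\vec a)$ for all models $\mathcal I$ of $\mathcal T$ and $\mathcal A$. For $\mathcal Q\in\{\text{PEQ},\text{CQ},\text{ELIQ}\}$, $\mathcal T$ is $\mathcal Q$-materializable if for every ABox $\mathcal A$ that has a common model with $\mathcal T$ there is a model $\mathcal I$ of $\mathcal T$ and $\mathcal A$ such that for all $q(\vec x)\in\mathcal Q$ and all tuples $\vec a$ in $\mathsf{Ind}(\mathcal A)$: $\mathcal I\models q(\vec a)$ iff $\mathcal T,\mathcal A\models q(\vec a)$. The unraveling $\mathcal A^u$ of $\mathcal A$ is the possibly infinite ABox whose individuals are the sequences $b_0r_0b_1\cdots r_{n-1}b_n$ ($n\ge 0$) with $b_i\in\mathsf{Ind}(\mathcal A)$, $r_i$ possibly inverse roles, $r_i(b_i,b_{i+1})\in\mathcal A$ for $i<n$ (where $r^-(a,b)\in\mathcal A$ means $r(b,a)\in\mathcal A$) and $(b_{i-1},r_{i-1}^-)\ne(b_{i+1},r_i)$ for $0<i<n$, and whose assertions are $A(\alpha)$ for each $\alpha=b_0\cdots b_n$ with $A(b_n)\in\mathcal A$, and $r_{n-1}(b_0\cdots b_{n-1},\alpha)$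 for each $\alpha=b_0\cdots r_{n-1}b_n$ with $n>0$. $\mathcal T$ is unraveling tolerant if for all ABoxes $\mathcal A$, ELIQs $C(x)$ and $a\in\mathsf{Ind}(\mathcal A)$, $\mathcal T,\mathcal A\models C(a)$ implies $\mathcal T,\mathcal A^u\models C(a)$. Theorem. Let $\mathcal T$ be an $\mathcal{ALCFI}$-TBox of depth one and let $\mathcal Q\in\{\text{PEQ},\text{CQ},\text{ELIQ}\}$. Then $\mathcal T$ is $\mathcal Q$-materializable if and only if $\mathcal T$ is unraveling tolerant. -/

import Mathlib

/-! ## Syntax: roles, concepts, TBoxes, ABoxes -/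

namespace ALCFI

/-- Concept names, a countably infinite set. -/
abbrev ConceptName : Type := ℕ

/-- Role names, a countably infinite set. -/
abbrev RoleName : Type := ℕ

/-- Individual names, a countably infinite set. -/
abbrev IndName : Type := ℕ

/-- Query variables. -/
abbrev Var : Type := ℕ

/-- Roles: role names `r` and inverse roles `r⁻`. -/
inductive Role : Type
  | name (r : RoleName)
  | inverse (r : RoleName)

/-- `r ↦ r⁻`, with `(r⁻)⁻ = r`. -/
def Role.inv : Role → Role
  | .name r => .inverse r
  | .inverse r => .name r

/-- `ALCI`-concepts (these are also the concepts of `ALCFI`-TBoxes). -/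
inductive Concept : Type
  | top
  | bot
  | atom (A : ConceptName)
  | and (C D : Concept)
  | or (C D : Concept)
  | not (C : Concept)
  | ex (r : Role) (C : Concept)
  | all (r : Role) (C : Concept)

/-- `ELI`-concepts: built from `⊤`, concept names, `⊓` and `∃ r.C` (with inverse roles). -/
def Concept.IsELI : Concept → Prop
  | .top => True
  | .bot => False
  | .atom _ => True
  | .and C D => C.IsELI ∧ D.IsELI
  | .or _ _ => False
  | .not _ => False
  | .ex _ C => C.IsELI
  | .all _ _ => False

/-- The nesting depth of the restrictions `∃ r.C` and `∀ r.C` in a concept. -/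
def Concept.depth : Concept → ℕ
  | .top => 0
  | .bot => 0
  | .atom _ => 0
  | .and C D => max C.depth D.depth
  | .or C D => max C.depth D.depth
  | .not C => C.depth
  | .ex _ C => C.depth + 1
  | .all _ C => C.depth + 1

/-- The axioms of an `ALCFI`-TBox: concept inclusions `C ⊑ D` and functionality assertions
`func(r)` for a possibly inverse role `r`. -/
inductive TBoxAxiom : Type
  | inclusion (C D : Concept)
  | func (r : Role)

/-- `ALCFI`-TBoxes. -/
abbrev TBox : Type := Finset TBoxAxiom

/-- A TBox of depth one: no restriction `∃ r.E`, `∀ r.E` in a concept inclusion of the TBox is in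
the scope of another restriction. -/
def TBox.DepthOne (T : TBox) : Prop :=
  ∀ C D : Concept, TBoxAxiom.inclusion C D ∈ T → C.depth ≤ 1 ∧ D.depth ≤ 1

/-- Assertions `A(a)` and `r(a,b)` over a set `N` of individuals. -/
inductive Assertion (N : Type) : Type
  | concept (A : ConceptName) (a : N)
  | role (r : RoleName) (a b : N)

/-- Possibly infinite ABoxes with individuals from `N`. (ABoxes proper are moreover finite, nonempty
and have individuals from `IndName`; this is required where they are quantified over.) -/
abbrev ABox (N : Type) : Type := Set (Assertion N)

/-- The individuals that occur in an assertion. -/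
def Assertion.inds {N : Type} : Assertion N → Set N
  | .concept _ a => {a}
  | .role _ a b => {a, b}

/-- `Ind(𝒜)`, the individuals used in the ABox. -/
def ABox.Ind {N : Type} (A : ABox N) : Set N :=
  {a | ∃ φ ∈ A, a ∈ φ.inds}

/-- `r(a,b) ∈ 𝒜` for a possibly inverse role, where `r⁻(a,b) ∈ 𝒜` means `r(b,a) ∈ 𝒜`. -/
def ABox.HasRole {N : Type} (A : ABox N) : Role → N → N → Prop
  | .name r, a, b => Assertion.role r a b ∈ A
  | .inverse r, a, b => Assertion.role r b a ∈ A

/-! ## Semantics -/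

/-- Interpretations. -/
structure Interp : Type 1 where
  dom : Type
  dom_nonempty : Nonempty dom
  concept : ConceptName → Set dom
  role : RoleName → dom → dom → Prop

/-- The extension of a possibly inverse role. -/
def Interp.roleExt (I : Interp) : Role → I.dom → I.dom → Prop
  | .name r, d, e => I.role r d e
  | .inverse r, d, e => I.role r e d

/-- The extension `C^ℐ` of a concept. -/
def Interp.ext (I : Interp) : Concept → Set I.dom
  | .top => Set.univ
  | .bot => ∅
  | .atom A => I.concept A
  | .and C D => I.ext C ∩ I.ext D
  | .or C D => I.ext C ∪ I.ext D
  | .not C => (I.ext C)ᶜ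
  | .ex r C => {d | ∃ e, I.roleExt r d e ∧ e ∈ I.ext C}
  | .all r C => {d | ∀ e, I.roleExt r d e → e ∈ I.ext C}

/-- Satisfaction of a TBox axiom. -/
def Interp.SatAxiom (I : Interp) : TBoxAxiom → Prop
  | .inclusion C D => I.ext C ⊆ I.ext D
  | .func r => ∀ d e e', I.roleExt r d e → I.roleExt r d e' → e = e'

/-- Satisfaction of an assertion, the individual `a` being the domain element `ι a`. -/
def Interp.SatAssertion {N : Type} (I : Interp) (ι : N → I.dom) : Assertion N → Prop
  | .concept A a => ι a ∈ I.concept A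
  | .role r a b => I.role r (ι a) (ι b)

/-- `ℐ` is a model of the TBox `T` and the ABox `A`. Under the standard name assumption the
individuals of `A` are themselves (distinct) domain elements; up to renaming of domain elements this
means that they are identified with domain elements by a map `ι` that is injective on `Ind(A)`.
The values of `ι` outside `Ind(A)` are irrelevant. -/
structure IsModel {N : Type} (T : TBox) (A : ABox N) (I : Interp) (ι : N → I.dom) : Prop where
  tbox : ∀ φ ∈ T, I.SatAxiom φ
  standardNames : Set.InjOn ι A.Ind
  abox : ∀ φ ∈ A, I.SatAssertion ι φ

/-- The ABox `A` is consistent w.r.t. the TBox `T`. -/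
def Consistent {N : Type} (T : TBox) (A : ABox N) : Prop :=
  ∃ (I : Interp) (ι : N → I.dom), IsModel T A I ι

/-! ## Queries and materializability -/

/-- Positive existential queries, as first-order formulas; `top` is the empty conjunction. The answer
variables are the free variables. -/
inductive PEQuery : Type
  | top
  | conceptAtom (A : ConceptName) (x : Var)
  | roleAtom (r : RoleName) (x y : Var)
  | and (p q : PEQuery)
  | or (p q : PEQuery)
  | ex (x : Var) (q : PEQuery)

/-- Conjunctive queries: positive existential queries without disjunction. -/
def PEQuery.IsCQ : PEQuery → Prop
  | .top => True
  | .conceptAtom _ _ => True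
  | .roleAtom _ _ _ => True
  | .and p q => p.IsCQ ∧ q.IsCQ
  | .or _ _ => False
  | .ex _ q => q.IsCQ

/-- The free variables of a query. -/
def PEQuery.freeVars : PEQuery → Set Var
  | .top => ∅
  | .conceptAtom _ x => {x}
  | .roleAtom _ x y => {x, y}
  | .and p q => p.freeVars ∪ q.freeVars
  | .or p q => p.freeVars ∪ q.freeVars
  | .ex x q => q.freeVars \ {x}

/-- `ℐ ⊨^π q`, in the standard first-order sense. -/
def Interp.SatQuery (I : Interp) : PEQuery → (Var → I.dom) → Prop
  | .top, _ => True
  | .conceptAtom A x, π => π x ∈ I.concept A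
  | .roleAtom r x y, π => I.role r (π x) (π y)
  | .and p q, π => I.SatQuery p π ∧ I.SatQuery q π
  | .or p q, π => I.SatQuery p π ∨ I.SatQuery q π
  | .ex x q, π => ∃ d : I.dom, I.SatQuery q (Function.update π x d)

/-- `T, A ⊨ q(a)`: certain answers to positive existential queries. The tuple `a` is given as
an assignment of individuals to variables, of which only the values at free variables matter. -/
def CertainPEQ {N : Type} (T : TBox) (A : ABox N) (q : PEQuery) (a : Var → N) : Prop :=
  ∀ (I : Interp) (ι : N → I.dom), IsModel T A I ι → I.SatQuery q (fun x => ι (a x))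

/-- `T, A ⊨ C(a)`: certain answers to the query `C(x)`. -/
def CertainConcept {N : Type} (T : TBox) (A : ABox N) (C : Concept) (a : N) : Prop :=
  ∀ (I : Interp) (ι : N → I.dom), IsModel T A I ι → ι a ∈ I.ext C

/-- The query languages for which materializability is considered. -/
inductive QueryLanguage : Type
  | PEQ
  | CQ
  | ELIQ

/-- `ℐ` gives the same answers as `T` and `A` to all queries of the query language. -/
def SameAnswers {N : Type} (T : TBox) (A : ABox N) (I : Interp) (ι : N → I.dom) :
    QueryLanguage → Prop
  | .PEQ => ∀ (q : PEQuery) (a : Var → N), (∀ x ∈ q.freeVars, a x ∈ A.Ind) →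
      (I.SatQuery q (fun x => ι (a x)) ↔ CertainPEQ T A q a)
  | .CQ => ∀ (q : PEQuery) (a : Var → N), q.IsCQ → (∀ x ∈ q.freeVars, a x ∈ A.Ind) →
      (I.SatQuery q (fun x => ι (a x)) ↔ CertainPEQ T A q a)
  | .ELIQ => ∀ (C : Concept) (a : N), C.IsELI → a ∈ A.Ind →
      (ι a ∈ I.ext C ↔ CertainConcept T A C a)

/-- `ℐ` is a `Q`-materialization of `T` and `A`. -/
def IsMaterialization {N : Type} (Q : QueryLanguage) (T : TBox) (A : ABox N)
    (I : Interp) (ι : N → I.dom) : Prop :=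
  IsModel T A I ι ∧ SameAnswers T A I ι Q

/-- `T` is `Q`-materializable: every (finite, nonempty) ABox that is consistent w.r.t. `T` has a
`Q`-materialization. -/
def Materializable (Q : QueryLanguage) (T : TBox) : Prop :=
  ∀ A : ABox IndName, A.Finite → A.Nonempty → Consistent T A →
    ∃ (I : Interp) (ι : IndName → I.dom), IsMaterialization Q T A I ι

/-! ## Unraveling -/

/-- Sequences `b₀ r₀ b₁ ⋯ rₙ₋₁ bₙ`: `snoc α r b` is `α r b`. -/
inductive Path (N : Type) : Type
  | start (b : N)
  | snoc (α : Path N) (r : Role) (b : N)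

/-- `tail(b₀ ⋯ bₙ) = bₙ`. -/
def Path.tail {N : Type} : Path N → N
  | .start b => b
  | .snoc _ _ b => b

/-- Extending the sequence by `r b` is no backtracking: for `⋯ bᵢ₋₁ rᵢ₋₁ bᵢ` this says
`(bᵢ₋₁, rᵢ₋₁⁻) ≠ (b, r)`. -/
def Path.NoBacktrack {N : Type} : Path N → Role → N → Prop
  | .start _, _, _ => True
  | .snoc α s _, r, b => (α.tail, s.inv) ≠ (b, r)

/-- The sequences that are the individuals of the unraveling. -/
def ABox.IsPath {N : Type} (A : ABox N) : Path N → Prop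
  | .start b => b ∈ A.Ind
  | .snoc α r b => A.IsPath α ∧ A.HasRole r α.tail b ∧ α.NoBacktrack r b

/-- The assertion `r(a,b)` for a possibly inverse role, where `r⁻(a,b)` is `r(b,a)`. -/
def Role.assertion {N : Type} : Role → N → N → Assertion N
  | .name r, a, b => .role r a b
  | .inverse r, a, b => .role r b a

/-- The unraveling `A^u` of an ABox. -/
def ABox.unravel {N : Type} (A : ABox N) : ABox (Path N) :=
  {φ | (∃ (B : ConceptName) (α : Path N), A.IsPath α ∧ Assertion.concept B α.tail ∈ A ∧
          φ = .concept B α) ∨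
       (∃ (α : Path N) (r : Role) (b : N), A.IsPath (.snoc α r b) ∧
          φ = r.assertion α (.snoc α r b))}

/-- The individuals used in `A^u` are exactly the sequences of the definition. -/
theorem ABox.ind_unravel {N : Type} (A : ABox N) : A.unravel.Ind = {α | A.IsPath α} := by
  have key : ∀ (r : Role) (α β : Path N), (r.assertion α β).inds = {α, β} := by
    intro r α β
    cases r
    · rfl
    · exact Set.pair_comm β α
  ext α
  constructor
  · rintro ⟨φ, hφ | hφ, hα⟩
    · obtain ⟨B, β, hβ, -, rfl⟩ := hφ
      have h : α = β := hα
      exact h ▸ hβ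
    · obtain ⟨β, r, b, hβ, rfl⟩ := hφ
      rw [key] at hα
      rcases hα with h | h
      · exact h ▸ hβ.1
      · have h' : α = _ := h
        exact h' ▸ hβ
  · intro hα
    cases α with
    | snoc β r b =>
      exact ⟨_, Or.inr ⟨β, r, b, hα, rfl⟩, by rw [key]; exact Or.inr rfl⟩
    | start a =>
      obtain ⟨φ, hφ, ha⟩ := hα
      have hmem : a ∈ A.Ind := ⟨φ, hφ, ha⟩
      have hrole : ∀ (r : Role) (b : N), A.HasRole r a b → Path.start a ∈ A.unravel.Ind :=
        fun r b h => ⟨_, Or.inr ⟨.start a, r, b, ⟨hmem, h, trivial⟩, rfl⟩,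
          by rw [key]; exact Or.inl rfl⟩
      cases φ with
      | concept B c =>
        have h : a = c := ha
        subst h
        exact ⟨_, Or.inl ⟨B, .start a, hmem, hφ, rfl⟩, rfl⟩
      | role r c d =>
        rcases ha with h | h
        · have h' : a = c := h
          subst h'
          exact hrole (.name r) d hφ
        · have h' : a = d := h
          subst h'
          exact hrole (.inverse r) c hφ

/-- `T` is unraveling tolerant: for all ABoxes `A` and ELIQs `C(a)`, `T, A ⊨ C(a)` implies
`T, A^u ⊨ C(a)`, where `a` is identified with the sequence of length zero. -/
def UnravelingTolerant (T : TBox) : Prop :=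
  ∀ A : ABox IndName, A.Finite → A.Nonempty →
    ∀ (C : Concept) (a : IndName), C.IsELI → a ∈ A.Ind →
      CertainConcept T A C a → CertainConcept T A.unravel C (.start a)

end ALCFI

namespace ALCFI

open Filter

/-! Both directions pass through ELIQ-materializability and rest on one construction. Let an ABox be
mapped into a model `I` of the TBox, with distinct `R`-neighbours of an individual represented by
distinct `R`-successors of its image. `Placement.forest` keeps the ABox as a core and hangs on each
individual the unraveling of `I` along the successors not yet represented. Every node then has
successors in bijection with those of its image. So functionality is inherited, and inclusions are
inherited as long as the representative of a neighbour and the image of that neighbour agree on the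
concepts under restrictions.

Materializable implies tolerant: by compactness the unraveling of `A`, if consistent, has an
ELIQ-materialization `I`. The individuals `b` and `aRb` of the unraveling have the same certain
answers, hence satisfy the same ELI-concepts in `I`. Place `A` in `I`, representing the edge from
`a` to `b` by the element for `aRb`. In depth one, the concepts under restrictions depend on concept
names only, so the forest is a model of `A`. It satisfies at `a` exactly the ELI-concepts certain at
`a` in the unraveling.

Tolerant implies materializable: certain answers of an ABox persist in all its coverings, since the
unraveling lifts to every covering (`certainConcept_of_lifts`). This yields a disjunction property.
If every model satisfied one of finitely many non-certain queries `C i (a i)`, a combined ABox would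
force the query `∃ first. ⊓ᵢ ∃ second i. C i` at a root. But a twisted covering can send each edge
towards `a j` into a sheet interpreted by a model that refutes `C j (a j)`. Compactness then refutes
all non-certain ELIQs at once.

To pass from ELIQs to PEQs, unravel an ELIQ-materialization into a forest over `A`; saturation maps
it homomorphically into an ultrapower of any given model. -/

theorem Role.inv_inv (r : Role) : r.inv.inv = r := by
  cases r <;> rfl

theorem Interp.roleExt_inv (I : Interp) (r : Role) (d e : I.dom) :
    I.roleExt r.inv d e ↔ I.roleExt r e d := by
  cases r <;> rfl

theorem ABox.hasRole_inv {N : Type} (A : ABox N) (r : Role) (a b : N) :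
    A.HasRole r.inv a b ↔ A.HasRole r b a := by
  cases r <;> rfl

/-! ### Transfer of concepts and axioms along local covers -/

/-- The concepts `E` such that `∃ r.E` or `∀ r.E` occurs in a concept. -/
def Concept.bodies : Concept → Set Concept
  | .top => ∅
  | .bot => ∅
  | .atom _ => ∅
  | .and C D => C.bodies ∪ D.bodies
  | .or C D => C.bodies ∪ D.bodies
  | .not C => C.bodies
  | .ex _ C => insert C C.bodies
  | .all _ C => insert C C.bodies

theorem Concept.depth_lt_of_mem_bodies {C E : Concept} (h : E ∈ C.bodies) :
    E.depth < C.depth := by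
  induction C with
  | top => exact h.elim
  | bot => exact h.elim
  | atom _ => exact h.elim
  | and C D ihC ihD =>
    rcases h with h | h
    · exact lt_max_of_lt_left (ihC h)
    · exact lt_max_of_lt_right (ihD h)
  | or C D ihC ihD =>
    rcases h with h | h
    · exact lt_max_of_lt_left (ihC h)
    · exact lt_max_of_lt_right (ihD h)
  | not C ih => exact ih h
  | ex r C ih =>
    rcases h with rfl | h
    · exact Nat.lt_succ_self _
    · exact (ih h).trans (Nat.lt_succ_self _)
  | all r C ih =>
    rcases h with rfl | h
    · exact Nat.lt_succ_self _
    · exact (ih h).trans (Nat.lt_succ_self _)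

theorem Concept.IsELI.of_mem_bodies {C E : Concept} (hC : C.IsELI) (h : E ∈ C.bodies) :
    E.IsELI := by
  induction C with
  | top => exact h.elim
  | bot => exact h.elim
  | atom _ => exact h.elim
  | and C D ihC ihD =>
    rcases h with h | h
    · exact ihC hC.1 h
    · exact ihD hC.2 h
  | or C D ihC ihD => exact hC.elim
  | not C ih => exact hC.elim
  | ex r C ih =>
    rcases h with rfl | h
    · exact hC
    · exact ih hC h
  | all r C ih => exact hC.elim

/-- Concepts without restrictions only depend on the concept names that hold at an element. -/
theorem Interp.mem_ext_iff_of_depth_eq_zero {I J : Interp} {d : I.dom} {e : J.dom}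
    (h : ∀ A, d ∈ I.concept A ↔ e ∈ J.concept A) {C : Concept} (hC : C.depth = 0) :
    d ∈ I.ext C ↔ e ∈ J.ext C := by
  induction C with
  | top => exact Iff.rfl
  | bot => exact Iff.rfl
  | atom A => exact h A
  | and C D ihC ihD =>
    obtain ⟨h1, h2⟩ := Nat.max_eq_zero_iff.1 hC
    exact and_congr (ihC h1) (ihD h2)
  | or C D ihC ihD =>
    obtain ⟨h1, h2⟩ := Nat.max_eq_zero_iff.1 hC
    exact or_congr (ihC h1) (ihD h2)
  | not C ih => exact not_congr (ih hC)
  | ex r C ih => exact absurd hC (Nat.succ_ne_zero _)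
  | all r C ih => exact absurd hC (Nat.succ_ne_zero _)

/-- `π` maps the elements of `J` to elements of `I` with the same concept names, and `ε x R` maps
the `R`-successors of `x` bijectively to those of `π x`. -/
structure LocalCover (J I : Interp) (π : J.dom → I.dom) (ε : J.dom → Role → J.dom → I.dom) :
    Prop where
  concept : ∀ A x, x ∈ J.concept A ↔ π x ∈ I.concept A
  edge : ∀ x R y, J.roleExt R x y → I.roleExt R (π x) (ε x R y)
  inj : ∀ x R y y', J.roleExt R x y → J.roleExt R x y' → ε x R y = ε x R y' → y = y'
  surj : ∀ x R d, I.roleExt R (π x) d → ∃ y, J.roleExt R x y ∧ ε x R y = d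

/-- `π y` and `ε x R y` agree on the concept `D`. -/
def AgreeOn (J I : Interp) (π : J.dom → I.dom) (ε : J.dom → Role → J.dom → I.dom)
    (D : Concept) : Prop :=
  ∀ x R y, J.roleExt R x y → (ε x R y ∈ I.ext D ↔ π y ∈ I.ext D)

/-- The bijection on successors handles the quantifier, but it leads to `ε x R y`, whereas the
induction hypothesis speaks about `π y`. Agreement is needed exactly at concepts under a
restriction; this is where depth one will enter. -/
theorem LocalCover.mem_ext_iff {J I : Interp} {π : J.dom → I.dom}
    {ε : J.dom → Role → J.dom → I.dom} (h : LocalCover J I π ε) {C : Concept}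
    (hC : ∀ D ∈ C.bodies, AgreeOn J I π ε D) (x : J.dom) :
    x ∈ J.ext C ↔ π x ∈ I.ext C := by
  induction C generalizing x with
  | top => exact Iff.rfl
  | bot => exact Iff.rfl
  | atom A => exact h.concept A x
  | and C D ihC ihD =>
    exact and_congr (ihC (fun E hE => hC E (Or.inl hE)) x) (ihD (fun E hE => hC E (Or.inr hE)) x)
  | or C D ihC ihD =>
    exact or_congr (ihC (fun E hE => hC E (Or.inl hE)) x) (ihD (fun E hE => hC E (Or.inr hE)) x)
  | not C ih => exact not_congr (ih hC x)
  | ex r C ih =>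
    have ih := ih fun E hE => hC E (Or.inr hE)
    have ag := hC C (Or.inl rfl)
    constructor
    · rintro ⟨y, hxy, hy⟩
      exact ⟨_, h.edge x r y hxy, (ag x r y hxy).2 ((ih y).1 hy)⟩
    · rintro ⟨d, hd, hdC⟩
      obtain ⟨y, hxy, rfl⟩ := h.surj x r d hd
      exact ⟨y, hxy, (ih y).2 ((ag x r y hxy).1 hdC)⟩
  | all r C ih =>
    have ih := ih fun E hE => hC E (Or.inr hE)
    have ag := hC C (Or.inl rfl)
    constructor
    · intro hx d hd
      obtain ⟨y, hxy, rfl⟩ := h.surj x r d hd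
      exact (ag x r y hxy).2 ((ih y).1 (hx y hxy))
    · intro hx y hxy
      exact (ih y).2 ((ag x r y hxy).1 (hx _ (h.edge x r y hxy)))

theorem LocalCover.satAxiom {J I : Interp} {π : J.dom → I.dom}
    {ε : J.dom → Role → J.dom → I.dom} (h : LocalCover J I π ε) {φ : TBoxAxiom}
    (hφ : ∀ C D, φ = .inclusion C D →
      (∀ E ∈ C.bodies, AgreeOn J I π ε E) ∧ ∀ E ∈ D.bodies, AgreeOn J I π ε E)
    (hI : I.SatAxiom φ) : J.SatAxiom φ := by
  cases φ with
  | inclusion C D =>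
    obtain ⟨hC, hD⟩ := hφ C D rfl
    intro x hx
    exact (h.mem_ext_iff hD x).2 (hI ((h.mem_ext_iff hC x).1 hx))
  | func R =>
    intro x y y' hy hy'
    exact h.inj x R y y' hy hy' (hI _ _ _ (h.edge x R y hy) (h.edge x R y' hy'))

/-! ### Forests over an ABox -/

/-- Trees of sequences `r₁ d₁ ⋯ rₙ dₙ` attached to individuals. -/
inductive Forest (N D : Type) : Type
  | root (a : N)
  | child (p : Forest N D) (r : Role) (d : D)

/-- The element of the interpretation that a node of a forest is a copy of. -/
def Forest.pt {N D : Type} (h : N → D) : Forest N D → D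
  | .root a => h a
  | .child _ _ d => d

/-- An ABox mapped into an interpretation such that the `R`-successors `b` of an individual `a` are
represented by different `R`-successors `e a R b` of the image of `a`. -/
structure Placement (N : Type) (B : ABox N) (I : Interp) where
  h : N → I.dom
  e : N → Role → N → I.dom
  concept : ∀ A a, Assertion.concept A a ∈ B → h a ∈ I.concept A
  edge : ∀ a R b, B.HasRole R a b → I.roleExt R (h a) (e a R b)
  inj : ∀ a R b b', B.HasRole R a b → B.HasRole R a b' → e a R b = e a R b' → b = b'

namespace Placement

variable {N : Type} {B : ABox N} {I : Interp} (P : Placement N B I)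

/-- The successor `d` of a node is not yet represented by the ABox or by the parent node. -/
def Fresh : Forest N I.dom → Role → I.dom → Prop
  | .root a, r, d => ∀ b, B.HasRole r a b → P.e a r b ≠ d
  | .child q s _, r, d => ¬(s = r.inv ∧ q.pt P.h = d)

/-- The nodes of the forest. -/
def Valid : Forest N I.dom → Prop
  | .root _ => True
  | .child p r d => Valid p ∧ I.roleExt r (p.pt P.h) d ∧ P.Fresh p r d

/-- The ABox with trees attached to its individuals, obtained by unraveling an interpretation. -/
def forest [Nonempty N] : Interp where
  dom := {p : Forest N I.dom // P.Valid p}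
  dom_nonempty := ‹Nonempty N›.elim fun a => ⟨⟨.root a, trivial⟩⟩
  concept A := {p | p.1.pt P.h ∈ I.concept A}
  role r x y := (∃ a b, Assertion.role r a b ∈ B ∧ x.1 = .root a ∧ y.1 = .root b) ∨
    (∃ d, y.1 = .child x.1 (.name r) d) ∨ ∃ d, x.1 = .child y.1 (.inverse r) d

variable [Nonempty N]

/-- Individuals as nodes of the forest. -/
def root (a : N) : P.forest.dom := ⟨.root a, trivial⟩

/-- The element that a node is a copy of. -/
def proj (x : P.forest.dom) : I.dom := x.1.pt P.h

/-- The successor in the interpretation that represents a successor of a node. -/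
def succ (x : P.forest.dom) (R : Role) (y : P.forest.dom) : I.dom :=
  match x.1, y.1 with
  | .root a, .root b => P.e a R b
  | _, q => q.pt P.h

theorem roleExt_forest (R : Role) (x y : P.forest.dom) :
    P.forest.roleExt R x y ↔ (∃ a b, B.HasRole R a b ∧ x.1 = .root a ∧ y.1 = .root b) ∨
      (∃ d, y.1 = .child x.1 R d) ∨ ∃ d, x.1 = .child y.1 R.inv d := by
  cases R with
  | name r => exact Iff.rfl
  | inverse r =>
    constructor
    · rintro (⟨a, b, h, h1, h2⟩ | h | h)
      · exact Or.inl ⟨b, a, h, h2, h1⟩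
      · exact Or.inr (Or.inr h)
      · exact Or.inr (Or.inl h)
    · rintro (⟨a, b, h, h1, h2⟩ | h | h)
      · exact Or.inl ⟨b, a, h, h2, h1⟩
      · exact Or.inr (Or.inr h)
      · exact Or.inr (Or.inl h)

theorem roleExt_root {R : Role} {a b : N} (h : B.HasRole R a b) :
    P.forest.roleExt R (P.root a) (P.root b) :=
  (P.roleExt_forest R _ _).2 (Or.inl ⟨a, b, h, rfl, rfl⟩)

theorem succ_eq_of_child_right {x y : P.forest.dom} (R : Role) {p : Forest N I.dom} {r : Role}
    {d : I.dom} (h : y.1 = .child p r d) : P.succ x R y = d := by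
  obtain ⟨x, hx⟩ := x
  obtain ⟨y, hy⟩ := y
  obtain rfl : y = _ := h
  cases x <;> rfl

theorem succ_eq_of_child_left {x y : P.forest.dom} (R : Role) {p : Forest N I.dom} {r : Role}
    {d : I.dom} (h : x.1 = .child p r d) : P.succ x R y = P.proj y := by
  obtain ⟨x, hx⟩ := x
  obtain rfl : x = _ := h
  rfl

/-- The neighbours of a node are ABox neighbours, children and possibly a parent. Freshness makes a
child present exactly when neither the ABox nor the parent represents the successor, so every
successor is represented exactly once. This is what preserves functionality. -/
theorem localCover : LocalCover P.forest I P.proj P.succ where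
  concept A x := Iff.rfl
  edge x R y hxy := by
    rcases (P.roleExt_forest R x y).1 hxy with ⟨a, b, h, h1, h2⟩ | ⟨d, hd⟩ | ⟨d, hd⟩
    · obtain rfl : x = P.root a := Subtype.ext h1
      obtain rfl : y = P.root b := Subtype.ext h2
      exact P.edge a R b h
    · rw [P.succ_eq_of_child_right R hd]
      have hy := y.2
      rw [hd] at hy
      exact hy.2.1
    · rw [P.succ_eq_of_child_left R hd]
      have hx := x.2
      rw [hd] at hx
      have h1 := (I.roleExt_inv _ _ _).1 hx.2.1
      have h2 : P.proj x = d := by rw [proj, hd]; rfl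
      rw [h2]
      exact h1
  inj x R y y' hxy hxy' heq := by
    have key : ∀ y y' : P.forest.dom, (∃ d, y.1 = .child x.1 R d) →
        (∃ d, x.1 = .child y'.1 R.inv d) → P.succ x R y ≠ P.succ x R y' := by
      rintro y y' ⟨d, hd⟩ ⟨d', hd'⟩ heq
      rw [P.succ_eq_of_child_right R hd, P.succ_eq_of_child_left R hd'] at heq
      have hy := y.2
      rw [hd] at hy
      have hf := hy.2.2
      rw [hd'] at hf
      exact hf ⟨rfl, heq.symm⟩
    have key' : ∀ y y' : P.forest.dom,
        (∃ a b, B.HasRole R a b ∧ x.1 = .root a ∧ y.1 = .root b) →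
        (∃ d, y'.1 = .child x.1 R d) → P.succ x R y ≠ P.succ x R y' := by
      rintro y y' ⟨a, b, h, h1, h2⟩ ⟨d, hd⟩ heq
      rw [P.succ_eq_of_child_right R hd] at heq
      obtain rfl : x = P.root a := Subtype.ext h1
      obtain rfl : y = P.root b := Subtype.ext h2
      have hy := y'.2
      rw [hd] at hy
      exact hy.2.2 b h heq
    rcases (P.roleExt_forest R x y).1 hxy with ⟨a, b, h, h1, h2⟩ | hd | hd <;>
    rcases (P.roleExt_forest R x y').1 hxy' with ⟨a', b', h', h1', h2'⟩ | hd' | hd'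
    · obtain rfl : x = P.root a := Subtype.ext h1
      obtain rfl : y = P.root b := Subtype.ext h2
      obtain rfl : y' = P.root b' := Subtype.ext h2'
      cases h1'
      rw [P.inj a R b b' h h' heq]
    · exact (key' y y' ⟨a, b, h, h1, h2⟩ hd' heq).elim
    · obtain ⟨d', hd'⟩ := hd'
      rw [h1] at hd'
      cases hd'
    · exact (key' y' y ⟨a', b', h', h1', h2'⟩ hd heq.symm).elim
    · obtain ⟨d, hd⟩ := hd
      obtain ⟨d', hd'⟩ := hd'
      rw [P.succ_eq_of_child_right R hd, P.succ_eq_of_child_right R hd'] at heq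
      exact Subtype.ext (by rw [hd, hd', heq])
    · exact (key y y' hd hd' heq).elim
    · obtain ⟨d, hd⟩ := hd
      rw [h1'] at hd
      cases hd
    · exact (key y' y hd' hd heq.symm).elim
    · obtain ⟨d, hd⟩ := hd
      obtain ⟨d', hd'⟩ := hd'
      rw [hd] at hd'
      injection hd' with h1
      exact Subtype.ext h1
  surj x R d hd := by
    by_cases hf : P.Fresh x.1 R d
    · exact ⟨⟨.child x.1 R d, x.2, hd, hf⟩, (P.roleExt_forest _ _ _).2 (Or.inr (Or.inl ⟨d, rfl⟩)),
        P.succ_eq_of_child_right R rfl⟩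
    · obtain ⟨x, hx⟩ := x
      cases x with
      | root a =>
        have hf : ¬∀ b, B.HasRole R a b → P.e a R b ≠ d := hf
        push Not at hf
        obtain ⟨b, hb, he⟩ := hf
        exact ⟨P.root b, P.roleExt_root hb, he⟩
      | child q s d' =>
        obtain ⟨rfl, rfl⟩ := not_not.1 hf
        exact ⟨⟨q, hx.1⟩, (P.roleExt_forest _ _ _).2 (Or.inr (Or.inr ⟨d', rfl⟩)),
          P.succ_eq_of_child_left R rfl⟩

/-- On nodes other than the individuals, `succ` and `proj` always agree. -/
theorem agreeOn {D : Concept}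
    (h : ∀ a R b, B.HasRole R a b → (P.e a R b ∈ I.ext D ↔ P.h b ∈ I.ext D)) :
    AgreeOn P.forest I P.proj P.succ D := by
  intro x R y hxy
  rcases (P.roleExt_forest R x y).1 hxy with ⟨a, b, hab, h1, h2⟩ | ⟨d, hd⟩ | ⟨d, hd⟩
  · obtain rfl : x = P.root a := Subtype.ext h1
    obtain rfl : y = P.root b := Subtype.ext h2
    exact h a R b hab
  · rw [P.succ_eq_of_child_right R hd, proj, hd]
    rfl
  · rw [P.succ_eq_of_child_left R hd]

theorem isModel_forest {T : TBox} (hI : ∀ φ ∈ T, I.SatAxiom φ)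
    (hT : ∀ C D, TBoxAxiom.inclusion C D ∈ T → ∀ E ∈ C.bodies ∪ D.bodies,
      AgreeOn P.forest I P.proj P.succ E) : IsModel T B P.forest P.root where
  tbox φ hφ := by
    refine P.localCover.satAxiom ?_ (hI φ hφ)
    rintro C D rfl
    exact ⟨fun E hE => hT C D hφ E (Or.inl hE), fun E hE => hT C D hφ E (Or.inr hE)⟩
  standardNames a _ b _ hab := by
    injection congrArg Subtype.val hab
  abox φ hφ := by
    cases φ with
    | concept A a => exact P.concept A a hφ
    | role r a b => exact P.roleExt_root (R := .name r) hφ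

/-- Placements by a locally injective homomorphism. -/
theorem mem_ext_forest (he : ∀ a R b, P.e a R b = P.h b) (C : Concept) (x : P.forest.dom) :
    x ∈ P.forest.ext C ↔ P.proj x ∈ I.ext C :=
  P.localCover.mem_ext_iff (fun D _ => P.agreeOn fun a R b _ => by rw [he]) x

theorem isModel_forest_of_eq {T : TBox} (hI : ∀ φ ∈ T, I.SatAxiom φ)
    (he : ∀ a R b, P.e a R b = P.h b) : IsModel T B P.forest P.root :=
  P.isModel_forest hI fun _ _ _ _ _ => P.agreeOn fun a R b _ => by rw [he]

end Placement

/-! ### Ultraproducts -/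

section Ultraproduct

variable {X : Type} (U : Ultrafilter X) (I : X → Interp)

/-- Ultraproducts of interpretations. -/
def Interp.ultraproduct : Interp where
  dom := Quotient (productSetoid (U : Filter X) fun x => (I x).dom)
  dom_nonempty := ⟨Quotient.mk (productSetoid (U : Filter X) _) fun x => (I x).dom_nonempty.some⟩
  concept A := {q | ∃ f, Quotient.mk (productSetoid (U : Filter X) _) f = q ∧
    ∀ᶠ x in U, f x ∈ (I x).concept A}
  role r p q := ∃ f g, Quotient.mk (productSetoid (U : Filter X) _) f = p ∧
    Quotient.mk (productSetoid (U : Filter X) _) g = q ∧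
    ∀ᶠ x in U, (I x).role r (f x) (g x)

/-- The class of a family of elements in the ultraproduct. -/
def Interp.ultraMk (f : ∀ x, (I x).dom) : (Interp.ultraproduct U I).dom :=
  Quotient.mk (productSetoid (U : Filter X) _) f

variable {U I}

theorem Interp.ultraMk_surjective (p : (Interp.ultraproduct U I).dom) :
    ∃ f, Interp.ultraMk U I f = p :=
  Quotient.exists_rep p

theorem Interp.ultraMk_eq_iff {f g : ∀ x, (I x).dom} :
    Interp.ultraMk U I f = Interp.ultraMk U I g ↔ ∀ᶠ x in U, f x = g x :=
  Quotient.eq (r := productSetoid (U : Filter X) _)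

theorem Interp.ultraMk_mem_concept {A : ConceptName} {f : ∀ x, (I x).dom} :
    Interp.ultraMk U I f ∈ (Interp.ultraproduct U I).concept A ↔
      ∀ᶠ x in U, f x ∈ (I x).concept A := by
  constructor
  · rintro ⟨g, hg, h⟩
    filter_upwards [Interp.ultraMk_eq_iff.1 hg, h] with x h1 h2
    rwa [← h1]
  · exact fun h => ⟨f, rfl, h⟩

theorem Interp.ultraMk_role {r : RoleName} {f g : ∀ x, (I x).dom} :
    (Interp.ultraproduct U I).role r (Interp.ultraMk U I f) (Interp.ultraMk U I g) ↔
      ∀ᶠ x in U, (I x).role r (f x) (g x) := by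
  constructor
  · rintro ⟨f', g', hf, hg, h⟩
    filter_upwards [Interp.ultraMk_eq_iff.1 hf, Interp.ultraMk_eq_iff.1 hg, h] with x h1 h2 h3
    rwa [← h1, ← h2]
  · exact fun h => ⟨f, g, rfl, rfl, h⟩

theorem Interp.ultraMk_roleExt {R : Role} {f g : ∀ x, (I x).dom} :
    (Interp.ultraproduct U I).roleExt R (Interp.ultraMk U I f) (Interp.ultraMk U I g) ↔
      ∀ᶠ x in U, (I x).roleExt R (f x) (g x) := by
  cases R
  · exact Interp.ultraMk_role
  · exact Interp.ultraMk_role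

theorem Interp.exists_ultraMk_iff {P : ∀ x, (I x).dom → Prop} :
    (∃ f : ∀ x, (I x).dom, ∀ᶠ x in U, P x (f x)) ↔ ∀ᶠ x in U, ∃ d, P x d := by
  constructor
  · rintro ⟨f, hf⟩
    exact hf.mono fun x hx => ⟨f x, hx⟩
  · intro h
    -- Indices without a witness get an arbitrary element; by `h` they form a negligible set.
    have h' : ∀ x, ∃ d : (I x).dom, (∃ d, P x d) → P x d := by
      intro x
      by_cases hx : ∃ d, P x d
      · obtain ⟨d, hd⟩ := hx
        exact ⟨d, fun _ => hd⟩
      · exact ⟨(I x).dom_nonempty.some, fun h => (hx h).elim⟩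
    choose f hf using h'
    exact ⟨f, h.mono hf⟩

/-- Łoś's theorem for concepts. -/
theorem Interp.ultraMk_mem_ext {C : Concept} {f : ∀ x, (I x).dom} :
    Interp.ultraMk U I f ∈ (Interp.ultraproduct U I).ext C ↔ ∀ᶠ x in U, f x ∈ (I x).ext C := by
  induction C generalizing f with
  | top => exact iff_of_true trivial (Eventually.of_forall fun _ => trivial)
  | bot =>
    refine iff_of_false (fun h => h) fun h => ?_
    obtain ⟨x, hx⟩ := h.exists
    exact hx
  | atom A => exact Interp.ultraMk_mem_concept
  | and C D ihC ihD => exact (and_congr ihC ihD).trans eventually_and.symm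
  | or C D ihC ihD => exact (or_congr ihC ihD).trans Ultrafilter.eventually_or.symm
  | not C ih => exact (not_congr ih).trans Ultrafilter.eventually_not.symm
  | ex R C ih =>
    refine Iff.trans ?_ Interp.exists_ultraMk_iff
    constructor
    · rintro ⟨e, he, heC⟩
      obtain ⟨g, rfl⟩ := Interp.ultraMk_surjective e
      exact ⟨g, (Interp.ultraMk_roleExt.1 he).and (ih.1 heC)⟩
    · rintro ⟨g, hg⟩
      exact ⟨_, Interp.ultraMk_roleExt.2 (hg.mono fun _ h => h.1), ih.2 (hg.mono fun _ h => h.2)⟩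
  | all R C ih =>
    rw [← not_iff_not, ← Ultrafilter.eventually_not]
    have h1 : (∀ᶠ x in U, f x ∉ (I x).ext (.all R C)) ↔
        ∀ᶠ x in U, ∃ d, (I x).roleExt R (f x) d ∧ d ∉ (I x).ext C := by
      refine eventually_congr (Eventually.of_forall fun x => ?_)
      simp [Interp.ext]
    rw [h1]
    refine Iff.trans ?_ Interp.exists_ultraMk_iff
    constructor
    · intro h
      have h : ¬∀ e, (Interp.ultraproduct U I).roleExt R (Interp.ultraMk U I f) e →
        e ∈ (Interp.ultraproduct U I).ext C := h
      push Not at h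
      obtain ⟨e, he, heC⟩ := h
      obtain ⟨g, rfl⟩ := Interp.ultraMk_surjective e
      rw [ih, ← Ultrafilter.eventually_not] at heC
      exact ⟨g, (Interp.ultraMk_roleExt.1 he).and heC⟩
    · rintro ⟨g, hg⟩ h
      have h2 := ih.1 (h _ (Interp.ultraMk_roleExt.2 (hg.mono fun _ h => h.1)))
      obtain ⟨x, hx, hx'⟩ := (h2.and hg).exists
      exact hx'.2 hx

/-- Łoś's theorem for positive existential queries. -/
theorem Interp.ultraproduct_satQuery {q : PEQuery} {π : Var → ∀ x, (I x).dom} :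
    (Interp.ultraproduct U I).SatQuery q (fun v => Interp.ultraMk U I (π v)) ↔
      ∀ᶠ x in U, (I x).SatQuery q fun v => π v x := by
  induction q generalizing π with
  | top => exact iff_of_true trivial (Eventually.of_forall fun _ => trivial)
  | conceptAtom A v => exact Interp.ultraMk_mem_concept
  | roleAtom r v w => exact Interp.ultraMk_role
  | and p q ihp ihq => exact (and_congr ihp ihq).trans eventually_and.symm
  | or p q ihp ihq => exact (or_congr ihp ihq).trans Ultrafilter.eventually_or.symm
  | ex v q ih =>
    refine Iff.trans ?_ Interp.exists_ultraMk_iff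
    have h1 : ∀ g : ∀ x, (I x).dom,
        Function.update (fun w => Interp.ultraMk U I (π w)) v (Interp.ultraMk U I g) =
          fun w => Interp.ultraMk U I (Function.update π v g w) := by
      intro g
      funext w
      by_cases h : w = v
      · subst h
        simp
      · simp [h]
    have h2 : ∀ (g : ∀ x, (I x).dom) (x : X),
        (fun w => Function.update π v g w x) = Function.update (fun w => π w x) v (g x) := by
      intro g x
      funext w
      by_cases h : w = v
      · subst h
        simp
      · simp [h]
    constructor
    · rintro ⟨e, he⟩
      obtain ⟨g, rfl⟩ := Interp.ultraMk_surjective e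
      rw [h1, ih] at he
      exact ⟨g, he.mono fun x hx => by rwa [h2] at hx⟩
    · rintro ⟨g, hg⟩
      refine ⟨Interp.ultraMk U I g, ?_⟩
      rw [h1, ih]
      exact hg.mono fun x hx => by rwa [h2]

theorem Interp.ultraproduct_satAxiom {φ : TBoxAxiom} (h : ∀ x, (I x).SatAxiom φ) :
    (Interp.ultraproduct U I).SatAxiom φ := by
  cases φ with
  | inclusion C D =>
    intro p hp
    obtain ⟨f, rfl⟩ := Interp.ultraMk_surjective p
    exact Interp.ultraMk_mem_ext.2 ((Interp.ultraMk_mem_ext.1 hp).mono fun x hx => h x hx)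
  | func R =>
    intro p q q' hq hq'
    obtain ⟨f, rfl⟩ := Interp.ultraMk_surjective p
    obtain ⟨g, rfl⟩ := Interp.ultraMk_surjective q
    obtain ⟨g', rfl⟩ := Interp.ultraMk_surjective q'
    refine Interp.ultraMk_eq_iff.2 ?_
    filter_upwards [Interp.ultraMk_roleExt.1 hq, Interp.ultraMk_roleExt.1 hq'] with x h1 h2
    exact h x _ _ _ h1 h2

/-- Ultraproducts of models of a TBox in which every assertion of an ABox holds eventually. -/
theorem isModel_ultraproduct {N : Type} {T : TBox} {A : ABox N} {B : X → ABox N}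
    {ι : ∀ x, N → (I x).dom} (h : ∀ x, IsModel T (B x) (I x) (ι x))
    (hA : ∀ φ ∈ A, ∀ᶠ x in U, φ ∈ B x) :
    IsModel T A (Interp.ultraproduct U I) fun a => Interp.ultraMk U I fun x => ι x a where
  tbox φ hφ := Interp.ultraproduct_satAxiom fun x => (h x).tbox φ hφ
  standardNames := by
    rintro a ⟨φ, hφ, ha⟩ b ⟨ψ, hψ, hb⟩ hab
    obtain ⟨x, h1, h2, h3⟩ :=
      ((Interp.ultraMk_eq_iff.1 hab).and ((hA φ hφ).and (hA ψ hψ))).exists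
    exact (h x).standardNames ⟨φ, h2, ha⟩ ⟨ψ, h3, hb⟩ h1
  abox φ hφ := by
    cases φ with
    | concept B a =>
      exact Interp.ultraMk_mem_concept.2 ((hA _ hφ).mono fun x hx => (h x).abox _ hx)
    | role r a b =>
      exact Interp.ultraMk_role.2 ((hA _ hφ).mono fun x hx => (h x).abox _ hx)

end Ultraproduct

/-! ### Saturation -/

/-- An injective numbering of roles. -/
def Role.code : Role → ℕ
  | .name r => Nat.pair 0 r
  | .inverse r => Nat.pair 1 r

theorem Role.code_injective : Function.Injective Role.code := by
  intro r s h
  cases r <;> cases s <;> simp_all [Role.code, Nat.pair_eq_pair]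

/-- An injective numbering of concepts. -/
def Concept.code : Concept → ℕ
  | .top => Nat.pair 0 0
  | .bot => Nat.pair 1 0
  | .atom A => Nat.pair 2 A
  | .and C D => Nat.pair 3 (Nat.pair C.code D.code)
  | .or C D => Nat.pair 4 (Nat.pair C.code D.code)
  | .not C => Nat.pair 5 C.code
  | .ex r C => Nat.pair 6 (Nat.pair r.code C.code)
  | .all r C => Nat.pair 7 (Nat.pair r.code C.code)

theorem Concept.code_injective : Function.Injective Concept.code := by
  intro C D h
  induction C generalizing D with
  | top => cases D <;> simp_all [Concept.code, Nat.pair_eq_pair]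
  | bot => cases D <;> simp_all [Concept.code, Nat.pair_eq_pair]
  | atom A => cases D <;> simp_all [Concept.code, Nat.pair_eq_pair]
  | and C C' ih ih' =>
    cases D <;> simp [Concept.code, Nat.pair_eq_pair] at h ⊢
    exact ⟨ih h.1, ih' h.2⟩
  | or C C' ih ih' =>
    cases D <;> simp [Concept.code, Nat.pair_eq_pair] at h ⊢
    exact ⟨ih h.1, ih' h.2⟩
  | not C ih =>
    cases D <;> simp [Concept.code, Nat.pair_eq_pair] at h ⊢
    exact ih h
  | ex r C ih =>
    cases D <;> simp [Concept.code, Nat.pair_eq_pair] at h ⊢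
    exact ⟨Role.code_injective h.1, ih h.2⟩
  | all r C ih =>
    cases D <;> simp [Concept.code, Nat.pair_eq_pair] at h ⊢
    exact ⟨Role.code_injective h.1, ih h.2⟩

/-- Finite conjunctions. -/
def Concept.conj : List Concept → Concept
  | [] => .top
  | C :: l => .and C (conj l)

theorem Interp.mem_ext_conj {I : Interp} {d : I.dom} {l : List Concept} :
    d ∈ I.ext (Concept.conj l) ↔ ∀ C ∈ l, d ∈ I.ext C := by
  induction l with
  | nil => exact iff_of_true trivial (by simp)
  | cons C l ih =>
    rw [List.forall_mem_cons, ← ih]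
    exact Iff.rfl

theorem Concept.isELI_conj {l : List Concept} (h : ∀ C ∈ l, C.IsELI) :
    (Concept.conj l).IsELI := by
  induction l with
  | nil => trivial
  | cons C l ih =>
    rw [List.forall_mem_cons] at h
    exact ⟨h.1, ih h.2⟩

/-- A nonprincipal ultrafilter on the natural numbers. -/
noncomputable def natUltrafilter : Ultrafilter ℕ := Ultrafilter.of atTop

theorem eventually_natUltrafilter (n : ℕ) : ∀ᶠ x in natUltrafilter, n ≤ x :=
  Ultrafilter.of_le atTop (eventually_ge_atTop n)

/-- The ultrapower with respect to a nonprincipal ultrafilter on the natural numbers. -/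
noncomputable def Interp.natPower (I : Interp) : Interp :=
  Interp.ultraproduct natUltrafilter fun _ => I

/-- In ultrapowers, there is a successor in all concepts of a set as soon as there are
successors in all finite conjunctions of concepts of the set. -/
theorem Interp.exists_succ_natPower (I : Interp) (p : I.natPower.dom) (R : Role) (S : Set Concept)
    (hS : ∀ l : List Concept, (∀ C ∈ l, C ∈ S) → p ∈ I.natPower.ext (.ex R (Concept.conj l))) :
    ∃ q, I.natPower.roleExt R p q ∧ ∀ C ∈ S, q ∈ I.natPower.ext C := by
  obtain ⟨g, rfl⟩ := Interp.ultraMk_surjective p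
  -- `Q n` asks only for the finitely many concepts of `S` with code at most `n`, so `hS` applies to
  -- it; it gets stronger as `n` grows.
  set Q : ℕ → ℕ → I.dom → Prop :=
    fun n x y => I.roleExt R (g x) y ∧ ∀ C ∈ S, C.code ≤ n → y ∈ I.ext C with hQ
  have h1 : ∀ n, ∀ᶠ x in natUltrafilter, ∃ y, Q n x y := by
    intro n
    have hfin : {C | C ∈ S ∧ C.code ≤ n}.Finite :=
      Set.Finite.subset (Set.Finite.preimage Concept.code_injective.injOn (Set.finite_Iic n))
        fun C hC => hC.2
    have h2 := hS hfin.toFinset.toList fun C hC => by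
      have : C ∈ S ∧ C.code ≤ n := by simpa using hC
      exact this.1
    refine (Interp.ultraMk_mem_ext.1 h2).mono ?_
    rintro x ⟨y, hy, hyC⟩
    refine ⟨y, hy, fun C hC hn => Interp.mem_ext_conj.1 hyC C ?_⟩
    simpa using And.intro hC hn
  -- Since the conditions are nested, a witness for the largest satisfiable one among `n ≤ k` serves
  -- all satisfiable ones.
  have h2 : ∀ x k, ∃ y, ∀ n ≤ k, (∃ y, Q n x y) → Q n x y := by
    intro x k
    induction k with
    | zero =>
      by_cases h : ∃ y, Q 0 x y
      · obtain ⟨y, hy⟩ := h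
        exact ⟨y, fun n hn _ => by rwa [Nat.le_zero.1 hn]⟩
      · exact ⟨g x, fun n hn h' => (h (by rwa [Nat.le_zero.1 hn] at h')).elim⟩
    | succ k ih =>
      by_cases h : ∃ y, Q (k + 1) x y
      · obtain ⟨y, hy⟩ := h
        exact ⟨y, fun n hn _ => ⟨hy.1, fun C hC hC' => hy.2 C hC (hC'.trans hn)⟩⟩
      · obtain ⟨y, hy⟩ := ih
        refine ⟨y, fun n hn h' => hy n ?_ h'⟩
        rcases Nat.le_succ_iff.1 hn with hn | rfl
        · exact hn
        · exact (h h').elim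
  -- Diagonal choice `k = x`: as the ultrafilter is nonprincipal, each fixed `n` is eventually at
  -- most `x`.
  choose y hy using fun x => h2 x x
  have h3 : ∀ n, ∀ᶠ x in natUltrafilter, Q n x (y x) := by
    intro n
    filter_upwards [h1 n, eventually_natUltrafilter n] with x hx hn
    exact hy x n hn hx
  refine ⟨Interp.ultraMk _ _ y, Interp.ultraMk_roleExt.2 ((h3 0).mono fun x hx => hx.1),
    fun C hC => Interp.ultraMk_mem_ext.2 ((h3 C.code).mono fun x hx => hx.2 C hC le_rfl)⟩

/-! ### Coverings of ABoxes -/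

theorem ABox.mem_ind_of_hasRole {N : Type} {A : ABox N} {R : Role} {a b : N}
    (h : A.HasRole R a b) : a ∈ A.Ind ∧ b ∈ A.Ind := by
  cases R with
  | name r => exact ⟨⟨_, h, Or.inl rfl⟩, ⟨_, h, Or.inr rfl⟩⟩
  | inverse r => exact ⟨⟨_, h, Or.inr rfl⟩, ⟨_, h, Or.inl rfl⟩⟩

theorem ABox.hasRole_unravel {N : Type} {A : ABox N} {R : Role} {α β : Path N} :
    A.unravel.HasRole R α β ↔ (∃ b, A.IsPath β ∧ β = .snoc α R b) ∨
      ∃ b, A.IsPath α ∧ α = .snoc β R.inv b := by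
  have key : ∀ r (α β : Path N), Assertion.role r α β ∈ A.unravel ↔
      (∃ b, A.IsPath β ∧ β = .snoc α (.name r) b) ∨
        ∃ b, A.IsPath α ∧ α = .snoc β (.inverse r) b := by
    intro r α β
    constructor
    · rintro (⟨B, γ, -, -, h⟩ | ⟨γ, S, b, hγ, h⟩)
      · cases h
      · cases S with
        | name s =>
          cases h
          exact Or.inl ⟨b, hγ, rfl⟩
        | inverse s =>
          cases h
          exact Or.inr ⟨b, hγ, rfl⟩
    · rintro (⟨b, h, rfl⟩ | ⟨b, h, rfl⟩)
      · exact Or.inr ⟨_, _, _, h, rfl⟩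
      · exact Or.inr ⟨_, _, _, h, rfl⟩
  cases R with
  | name r => exact key r α β
  | inverse r => exact (key r β α).trans or_comm

theorem ABox.isPath_of_concept_mem_unravel {N : Type} {A : ABox N} {B : ConceptName} {α : Path N}
    (h : Assertion.concept B α ∈ A.unravel) : A.IsPath α ∧ Assertion.concept B α.tail ∈ A := by
  rcases h with ⟨B', α', h1, h2, h⟩ | ⟨α', r, b, -, h⟩
  · cases h
    exact ⟨h1, h2⟩
  · cases r <;> cases h

/-- A child whose role and tail match those of the parent would be backtracking, which paths
exclude. Hence the tail map is injective on the `R`-neighbours of each path. -/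
theorem ABox.unravel_unique {N : Type} {A : ABox N} {R : Role} {α β β' : Path N}
    (h : A.unravel.HasRole R α β) (h' : A.unravel.HasRole R α β') (ht : β.tail = β'.tail) :
    β = β' := by
  have key : ∀ (β β' : Path N) (b c : N), A.IsPath β → β = .snoc α R b → α = .snoc β' R.inv c →
      β.tail ≠ β'.tail := by
    rintro β β' b c hβ rfl rfl ht
    exact hβ.2.2 (by rw [Role.inv_inv, ← ht]; rfl)
  rcases ABox.hasRole_unravel.1 h with ⟨b, hb, hb'⟩ | ⟨b, hb, hb'⟩ <;>
  rcases ABox.hasRole_unravel.1 h' with ⟨c, hc, hc'⟩ | ⟨c, hc, hc'⟩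
  · subst hb' hc'
    obtain rfl : b = c := ht
    rfl
  · exact (key _ _ b c hb hb' hc' ht).elim
  · exact (key _ _ c b hc hc' hb' ht.symm).elim
  · rw [hb'] at hc'
    injection hc'

/-- All assertions of `A` about the image of an individual of `B` lift to `B`. -/
structure Lifts {M N : Type} (f : M → N) (B : ABox M) (A : ABox N) : Prop where
  concept : ∀ C x, x ∈ B.Ind → Assertion.concept C (f x) ∈ A → Assertion.concept C x ∈ B
  role : ∀ R x b, x ∈ B.Ind → A.HasRole R (f x) b → ∃ y, B.HasRole R x y ∧ f y = b

/-- An edge of `A` lifts to a child, unless this would be backtracking; then it lifts to the step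
back to the parent. -/
theorem ABox.lifts_unravel {N : Type} (A : ABox N) : Lifts Path.tail A.unravel A where
  concept C α hα h := by
    rw [ABox.ind_unravel] at hα
    exact Or.inl ⟨C, α, hα, h, rfl⟩
  role R α b hα h := by
    rw [ABox.ind_unravel] at hα
    by_cases hb : α.NoBacktrack R b
    · exact ⟨.snoc α R b, ABox.hasRole_unravel.2 (Or.inl ⟨b, ⟨hα, h, hb⟩, rfl⟩), rfl⟩
    · cases α with
      | start a => exact (hb trivial).elim
      | snoc β S c =>
        have hb : ¬(β.tail, S.inv) ≠ (b, R) := hb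
        rw [not_not, Prod.mk.injEq] at hb
        obtain ⟨h1, h2⟩ := hb
        refine ⟨β, ABox.hasRole_unravel.2 (Or.inr ⟨c, hα, ?_⟩), h1⟩
        rw [← h2, Role.inv_inv]

/-! ### Path lifting and certain answers in coverings -/

/-- Lifting the sequences of the unraveling of an ABox along a covering. -/
noncomputable def Path.lift {M N : Type} [Nonempty M] (f : M → N) (B : ABox M) (s : N → M) :
    Path N → M
  | .start a => s a
  | .snoc α R b => Classical.epsilon fun y => B.HasRole R (Path.lift f B s α) y ∧ f y = b

theorem Path.lift_start {M N : Type} [Nonempty M] (f : M → N) (B : ABox M) (s : N → M) (a : N) :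
    Path.lift f B s (.start a) = s a := rfl

section Lift

variable {M N : Type} [Nonempty M] {f : M → N} {B : ABox M} {A : ABox N} {s : N → M}

theorem Path.lift_spec (hf : Lifts f B A)
    (hs : ∀ a ∈ A.Ind, s a ∈ B.Ind ∧ f (s a) = a) {α : Path N} (hα : A.IsPath α) :
    (Path.lift f B s α ∈ B.Ind ∧ f (Path.lift f B s α) = α.tail) := by
  induction α with
  | start a => exact hs a hα
  | snoc α R b ih =>
    obtain ⟨h1, h2⟩ := ih hα.1
    have h3 := hf.role R _ b h1 (by rw [h2]; exact hα.2.1)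
    have h4 := Classical.epsilon_spec h3
    exact ⟨(ABox.mem_ind_of_hasRole h4.1).2, h4.2⟩

theorem Path.hasRole_lift_snoc (hf : Lifts f B A)
    (hs : ∀ a ∈ A.Ind, s a ∈ B.Ind ∧ f (s a) = a) {α : Path N} {R : Role} {b : N}
    (hα : A.IsPath (.snoc α R b)) :
    B.HasRole R (Path.lift f B s α) (Path.lift f B s (.snoc α R b)) := by
  obtain ⟨h1, h2⟩ := Path.lift_spec hf hs hα.1
  have h3 := hf.role R _ b h1 (by rw [h2]; exact hα.2.1)
  exact (Classical.epsilon_spec h3).1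

theorem Path.hasRole_lift (hf : Lifts f B A)
    (hs : ∀ a ∈ A.Ind, s a ∈ B.Ind ∧ f (s a) = a) {R : Role} {α β : Path N}
    (h : A.unravel.HasRole R α β) :
    B.HasRole R (Path.lift f B s α) (Path.lift f B s β) := by
  rcases ABox.hasRole_unravel.1 h with ⟨b, hb, rfl⟩ | ⟨b, hb, rfl⟩
  · exact Path.hasRole_lift_snoc hf hs hb
  · exact (B.hasRole_inv R _ _).1 (Path.hasRole_lift_snoc hf hs hb)

/-- Certain answers in the unraveling of an ABox are certain in all coverings of the ABox. -/
theorem CertainConcept.of_unravel {T : TBox} {C : Concept} {α : Path N}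
    (h : CertainConcept T A.unravel C α) (hf : Lifts f B A)
    (hs : ∀ a ∈ A.Ind, s a ∈ B.Ind ∧ f (s a) = a) : CertainConcept T B C (Path.lift f B s α) := by
  intro K κ hK
  -- The lift need not be injective on paths, so `K` itself need not be a model of the unraveling
  -- under standard names. It is injective on the `R`-neighbours of a path, because `f` recovers
  -- their tails, and the forest separates the rest.
  let P : Placement (Path N) A.unravel K :=
    { h := fun α => κ (Path.lift f B s α)
      e := fun _ _ β => κ (Path.lift f B s β)
      concept := by
        intro D β hβ
        obtain ⟨h1, h2⟩ := ABox.isPath_of_concept_mem_unravel hβ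
        obtain ⟨h3, h4⟩ := Path.lift_spec hf hs h1
        exact hK.abox _ (hf.concept D _ h3 (by rwa [h4]))
      edge := by
        intro β R γ hβ
        have h1 := Path.hasRole_lift hf hs hβ
        cases R with
        | name r => exact hK.abox _ h1
        | inverse r => exact hK.abox _ h1
      inj := by
        intro β R γ γ' hγ hγ' heq
        have h1 := hK.standardNames (ABox.mem_ind_of_hasRole (Path.hasRole_lift hf hs hγ)).2
          (ABox.mem_ind_of_hasRole (Path.hasRole_lift hf hs hγ')).2 heq
        have h2 : ∀ {δ}, δ ∈ A.unravel.Ind → f (Path.lift f B s δ) = δ.tail := fun {δ} hδ => by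
          rw [ABox.ind_unravel] at hδ
          exact (Path.lift_spec hf hs hδ).2
        refine ABox.unravel_unique hγ hγ' ?_
        rw [← h2 (ABox.mem_ind_of_hasRole hγ).2, ← h2 (ABox.mem_ind_of_hasRole hγ').2, h1] }
  have : Nonempty (Path N) := ⟨α⟩
  have h1 := h _ _ (P.isModel_forest_of_eq hK.tbox fun _ _ _ => rfl)
  exact (P.mem_ext_forest (fun _ _ _ => rfl) C _).1 h1

end Lift

/-- The extension of an individual sequence of length zero by one step has the same certain answers
as the sequence of length zero for the last individual. -/
theorem certainConcept_unravel_snoc_iff {N : Type} {T : TBox} {A : ABox N} {R : Role} {a b : N}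
    (h : A.HasRole R a b) (C : Concept) :
    CertainConcept T A.unravel C (.snoc (.start a) R b) ↔ CertainConcept T A.unravel C (.start b) := by
  classical
  obtain ⟨ha, hb⟩ := ABox.mem_ind_of_hasRole h
  have hs0 : ∀ c ∈ A.Ind, Path.start c ∈ A.unravel.Ind ∧ (Path.start c).tail = c := by
    intro c hc
    rw [ABox.ind_unravel]
    exact ⟨hc, rfl⟩
  have hpath : A.IsPath (.snoc (.start a) R b) := ⟨ha, h, trivial⟩
  have hpath' : A.IsPath (.snoc (.start b) R.inv a) := ⟨hb, (A.hasRole_inv R _ _).2 h, trivial⟩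
  have : Nonempty (Path N) := ⟨.start a⟩
  constructor
  · intro hC
    -- The unraveling covers `A`, so lifts may start anywhere above `a`. Starting at the path
    -- `bR⁻a`, the lift of `aRb` has to step back to `b`.
    have hs : ∀ c ∈ A.Ind, Function.update Path.start a (.snoc (.start b) R.inv a) c ∈ A.unravel.Ind ∧
        (Function.update Path.start a (.snoc (.start b) R.inv a) c).tail = c := by
      intro c hc
      by_cases hca : c = a
      · subst hca
        rw [Function.update_self, ABox.ind_unravel]
        exact ⟨hpath', rfl⟩
      · rw [Function.update_of_ne hca]
        exact hs0 c hc
    have h1 := hC.of_unravel A.lifts_unravel hs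
    have h2 := Path.hasRole_lift_snoc A.lifts_unravel hs hpath
    have h3 := (Path.lift_spec A.lifts_unravel hs hpath).2
    rw [Path.lift_start, Function.update_self] at h2
    have h4 : A.unravel.HasRole R (.snoc (.start b) R.inv a) (.start b) :=
      ABox.hasRole_unravel.2 (Or.inr ⟨a, hpath', rfl⟩)
    rwa [ABox.unravel_unique h2 h4 h3] at h1
  · intro hC
    -- Here the lift of `b` simply starts at `aRb`.
    have hs : ∀ c ∈ A.Ind, Function.update Path.start b (.snoc (.start a) R b) c ∈ A.unravel.Ind ∧
        (Function.update Path.start b (.snoc (.start a) R b) c).tail = c := by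
      intro c hc
      by_cases hcb : c = b
      · subst hcb
        rw [Function.update_self, ABox.ind_unravel]
        exact ⟨hpath, rfl⟩
      · rw [Function.update_of_ne hcb]
        exact hs0 c hc
    have h1 := hC.of_unravel A.lifts_unravel hs
    rwa [Path.lift_start, Function.update_self] at h1

/-! ### Renaming individuals -/

/-- Renaming the individuals of an assertion. -/
def Assertion.map {M N : Type} (g : M → N) : Assertion M → Assertion N
  | .concept A a => .concept A (g a)
  | .role r a b => .role r (g a) (g b)

theorem Interp.satAssertion_map {M N : Type} {I : Interp} {g : M → N} {ι : N → I.dom}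
    {φ : Assertion M} : I.SatAssertion ι (φ.map g) ↔ I.SatAssertion (ι ∘ g) φ := by
  cases φ <;> rfl

theorem Interp.satAssertion_congr {N : Type} {I : Interp} {ι κ : N → I.dom} {φ : Assertion N}
    (h : ∀ a ∈ φ.inds, ι a = κ a) : I.SatAssertion ι φ ↔ I.SatAssertion κ φ := by
  cases φ with
  | concept A a =>
    change ι a ∈ _ ↔ κ a ∈ _
    rw [h a rfl]
  | role r a b =>
    change I.role r (ι a) (ι b) ↔ I.role r (κ a) (κ b)
    rw [h a (Or.inl rfl), h b (Or.inr rfl)]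

theorem Assertion.inds_map {M N : Type} (g : M → N) (φ : Assertion M) :
    (φ.map g).inds = g '' φ.inds := by
  cases φ with
  | concept A a => exact Set.image_singleton.symm
  | role r a b => exact (Set.image_pair g a b).symm

theorem Assertion.inds_finite {N : Type} (φ : Assertion N) : φ.inds.Finite := by
  cases φ with
  | concept A a => exact Set.finite_singleton a
  | role r a b => exact Set.toFinite {a, b}

theorem ABox.ind_finite {N : Type} {A : ABox N} (hA : A.Finite) : A.Ind.Finite := by
  refine (hA.biUnion fun φ _ => φ.inds_finite).subset ?_
  rintro a ⟨φ, hφ, ha⟩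
  exact Set.mem_biUnion hφ ha

theorem ABox.ind_nonempty {N : Type} {A : ABox N} (hA : A.Nonempty) : A.Ind.Nonempty := by
  obtain ⟨φ, hφ⟩ := hA
  cases φ with
  | concept A a => exact ⟨a, _, hφ, rfl⟩
  | role r a b => exact ⟨a, _, hφ, Or.inl rfl⟩

theorem ABox.ind_image {M N : Type} (g : M → N) (A : ABox M) :
    ABox.Ind (Assertion.map g '' A) = g '' A.Ind := by
  ext b
  constructor
  · rintro ⟨_, ⟨φ, hφ, rfl⟩, hb⟩
    rw [Assertion.inds_map] at hb
    obtain ⟨a, ha, rfl⟩ := hb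
    exact ⟨a, ⟨φ, hφ, ha⟩, rfl⟩
  · rintro ⟨a, ⟨φ, hφ, ha⟩, rfl⟩
    exact ⟨_, ⟨φ, hφ, rfl⟩, by rw [Assertion.inds_map]; exact ⟨a, ha, rfl⟩⟩

theorem IsModel.congr {N : Type} {T : TBox} {A : ABox N} {I : Interp} {ι κ : N → I.dom}
    (h : IsModel T A I ι) (hικ : Set.EqOn ι κ A.Ind) : IsModel T A I κ where
  tbox := h.tbox
  standardNames := h.standardNames.congr hικ
  abox φ hφ := (Interp.satAssertion_congr fun _ ha => hικ ⟨φ, hφ, ha⟩).1 (h.abox φ hφ)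

theorem ABox.ind_mono {N : Type} {A B : ABox N} (h : A ⊆ B) : A.Ind ⊆ B.Ind := by
  rintro a ⟨φ, hφ, ha⟩
  exact ⟨φ, h hφ, ha⟩

theorem IsModel.mono {N : Type} {T : TBox} {A B : ABox N} {I : Interp} {ι : N → I.dom}
    (h : IsModel T B I ι) (hAB : A ⊆ B) : IsModel T A I ι where
  tbox := h.tbox
  standardNames := h.standardNames.mono (ABox.ind_mono hAB)
  abox φ hφ := h.abox φ (hAB hφ)

theorem isModel_image_iff {M N : Type} {T : TBox} {A : ABox M} {g : M → N}
    (hg : Set.InjOn g A.Ind) {I : Interp} {ι : N → I.dom} :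
    IsModel T (Assertion.map g '' A) I ι ↔ IsModel T A I (ι ∘ g) := by
  constructor
  · intro h
    refine ⟨h.tbox, ?_, fun φ hφ => Interp.satAssertion_map.1 (h.abox _ ⟨φ, hφ, rfl⟩)⟩
    have h1 := h.standardNames
    rw [ABox.ind_image] at h1
    exact h1.comp hg (Set.mapsTo_image g _)
  · intro h
    refine ⟨h.tbox, ?_, ?_⟩
    · rw [ABox.ind_image]
      rintro _ ⟨a, ha, rfl⟩ _ ⟨b, hb, rfl⟩ hab
      exact congrArg g (h.standardNames ha hb hab)
    · rintro _ ⟨φ, hφ, rfl⟩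
      exact Interp.satAssertion_map.2 (h.abox φ hφ)

theorem IsModel.exists_image {M N : Type} {T : TBox} {A : ABox M} {g : M → N}
    (hg : Set.InjOn g A.Ind) {I : Interp} {ι : M → I.dom} (h : IsModel T A I ι) :
    ∃ κ : N → I.dom, IsModel T (Assertion.map g '' A) I κ ∧ ∀ a ∈ A.Ind, κ (g a) = ι a := by
  classical
  have h1 : ∀ b, ∃ d, ∀ a ∈ A.Ind, g a = b → d = ι a := by
    intro b
    by_cases hb : ∃ a ∈ A.Ind, g a = b
    · obtain ⟨a, ha, rfl⟩ := hb
      exact ⟨ι a, fun a' ha' h' => congrArg ι (hg ha ha' h'.symm)⟩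
    · exact ⟨I.dom_nonempty.some, fun a ha hab => (hb ⟨a, ha, hab⟩).elim⟩
  choose κ hκ using h1
  have h2 : ∀ a ∈ A.Ind, κ (g a) = ι a := fun a ha => hκ (g a) a ha rfl
  exact ⟨κ, (isModel_image_iff hg).2 (h.congr fun a ha => (h2 a ha).symm), h2⟩

theorem certainConcept_image_iff {M N : Type} {T : TBox} {A : ABox M} {g : M → N}
    (hg : Set.InjOn g A.Ind) {C : Concept} {a : M} (ha : a ∈ A.Ind) :
    CertainConcept T (Assertion.map g '' A) C (g a) ↔ CertainConcept T A C a := by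
  constructor
  · intro h I ι hI
    obtain ⟨κ, hκ, hκι⟩ := hI.exists_image hg
    rw [← hκι a ha]
    exact h I κ hκ
  · intro h I ι hI
    exact h I _ ((isModel_image_iff hg).1 hI)

theorem ABox.exists_injOn_ind {N : Type} {A : ABox N} (hA : A.Finite) :
    ∃ g : N → IndName, Set.InjOn g A.Ind :=
  Set.countable_iff_exists_injOn.1 (ABox.ind_finite hA).countable

/-! ### Materializable TBoxes of depth one are unraveling tolerant -/

/-- Materializability extends to infinite ABoxes. -/
theorem Materializable.exists_isMaterialization {T : TBox} (hT : Materializable .ELIQ T) {N : Type}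
    {A : ABox N} (hA : A.Nonempty) (hc : Consistent T A) :
    ∃ (I : Interp) (ι : N → I.dom), IsMaterialization .ELIQ T A I ι := by
  classical
  obtain ⟨φ₀, hφ₀⟩ := hA
  -- Adding `φ₀` keeps the finite subsets nonempty, as materializability requires.
  let B : Finset (Assertion N) → ABox N := fun F => {φ | φ ∈ A ∧ φ ∈ insert φ₀ F}
  have hBA : ∀ F, B F ⊆ A := fun F φ hφ => hφ.1
  have hfin : ∀ F, (B F).Finite := fun F => (insert φ₀ F).finite_toSet.subset fun φ hφ => hφ.2
  have h1 : ∀ F, ∃ (I : Interp) (ι : N → I.dom), IsModel T (B F) I ι ∧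
      ∀ C a, C.IsELI → a ∈ (B F).Ind → ι a ∈ I.ext C → CertainConcept T (B F) C a := by
    intro F
    obtain ⟨g, hg⟩ := ABox.exists_injOn_ind (hfin F)
    obtain ⟨J, κ, hJ⟩ := hc
    obtain ⟨κ', hκ', -⟩ := (hJ.mono (hBA F)).exists_image hg
    obtain ⟨I, ι, hI, hI'⟩ := hT (Assertion.map g '' B F) ((hfin F).image _)
      ⟨_, φ₀, ⟨hφ₀, Finset.mem_insert_self _ _⟩, rfl⟩ ⟨J, κ', hκ'⟩
    refine ⟨I, ι ∘ g, (isModel_image_iff hg).1 hI, fun C a hC ha h => ?_⟩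
    rw [← certainConcept_image_iff hg ha]
    exact (hI' C (g a) hC (by rw [ABox.ind_image]; exact ⟨a, ha, rfl⟩)).1 h
  choose I ι hI hcert using h1
  have hev : ∀ φ ∈ A, ∀ᶠ F in (Ultrafilter.of atTop : Ultrafilter (Finset (Assertion N))),
      φ ∈ B F := by
    intro φ hφ
    refine Ultrafilter.of_le atTop ?_
    filter_upwards [eventually_ge_atTop {φ}] with F hF
    exact ⟨hφ, Finset.mem_insert_of_mem (hF (Finset.mem_singleton_self φ))⟩
  have hmod := isModel_ultraproduct hI hev
  refine ⟨_, _, hmod, fun C a hC ha => ⟨fun h => ?_, fun h => h _ _ hmod⟩⟩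
  -- A concept true in the ultraproduct is true in some factor whose ABox already contains `a`; it
  -- is certain there, hence also for the larger `A`.
  obtain ⟨φ, hφ, haφ⟩ := ha
  obtain ⟨F, hF, hFφ⟩ := ((Interp.ultraMk_mem_ext.1 h).and (hev φ hφ)).exists
  have := hcert F C a hC ⟨φ, hFφ, haφ⟩ hF
  exact fun J κ hJ => this J κ (hJ.mono (hBA F))

theorem ABox.hasRole_unravel_start {N : Type} {A : ABox N} {R : Role} {a b : N}
    (h : A.HasRole R a b) : A.unravel.HasRole R (.start a) (.snoc (.start a) R b) :=
  ABox.hasRole_unravel.2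
    (Or.inl ⟨b, ⟨(ABox.mem_ind_of_hasRole h).1, h, trivial⟩, rfl⟩)

theorem Interp.roleExt_of_isModel {N : Type} {T : TBox} {A : ABox N} {I : Interp} {ι : N → I.dom}
    (h : IsModel T A I ι) {R : Role} {a b : N} (hab : A.HasRole R a b) :
    I.roleExt R (ι a) (ι b) := by
  cases R with
  | name r => exact h.abox _ hab
  | inverse r => exact h.abox _ hab

/-- A materialization of the unraveling is folded back onto `A`: identifying the endpoint of the
path `aRb` with `b` changes no ELI-concept, and depth one ensures that the TBox does not notice it
either. -/
theorem UnravelingTolerant.of_materializable {T : TBox} (hT : T.DepthOne)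
    (hm : Materializable .ELIQ T) : UnravelingTolerant T := by
  intro A hfin hne C₀ a₀ hC₀ ha₀ hcert
  by_contra hnot
  -- An inconsistent unraveling would make `C₀` vacuously certain.
  have hcons : Consistent T A.unravel := by
    by_contra hcons
    exact hnot fun I ι hI => (hcons ⟨I, ι, hI⟩).elim
  have hind : ∀ {a}, a ∈ A.Ind → Path.start a ∈ A.unravel.Ind := fun {a} ha => by
    rw [ABox.ind_unravel]
    exact ha
  have hne' : A.unravel.Nonempty := by
    obtain ⟨φ, hφ, -⟩ := hind ha₀
    exact ⟨φ, hφ⟩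
  obtain ⟨I, ι, hI, hI'⟩ := hm.exists_isMaterialization hne' hcons
  have hagree : ∀ (C : Concept), C.IsELI → ∀ a R b, A.HasRole R a b →
      (ι (.snoc (.start a) R b) ∈ I.ext C ↔ ι (.start b) ∈ I.ext C) := by
    intro C hC a R b hab
    rw [hI' C _ hC (ABox.mem_ind_of_hasRole (ABox.hasRole_unravel_start hab)).2,
      hI' C _ hC (hind (ABox.mem_ind_of_hasRole hab).2)]
    exact certainConcept_unravel_snoc_iff hab C
  let P : Placement IndName A I :=
    { h := fun a => ι (.start a)
      e := fun a R b => ι (.snoc (.start a) R b)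
      concept := fun B a ha => hI.abox _ (Or.inl ⟨B, .start a, (⟨_, ha, rfl⟩ : a ∈ A.Ind), ha, rfl⟩)
      edge := fun a R b hab => Interp.roleExt_of_isModel hI (ABox.hasRole_unravel_start hab)
      inj := by
        intro a R b b' hb hb' heq
        have h1 := hI.standardNames (ABox.mem_ind_of_hasRole (ABox.hasRole_unravel_start hb)).2
          (ABox.mem_ind_of_hasRole (ABox.hasRole_unravel_start hb')).2 heq
        injection h1 }
  have hmod : IsModel T A P.forest P.root := by
    refine P.isModel_forest hI.tbox fun C D hCD E hE => P.agreeOn fun a R b hab => ?_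
    have hE : E.depth = 0 := by
      obtain ⟨h1, h2⟩ := hT C D hCD
      rcases hE with hE | hE
      · have := Concept.depth_lt_of_mem_bodies hE
        omega
      · have := Concept.depth_lt_of_mem_bodies hE
        omega
    exact Interp.mem_ext_iff_of_depth_eq_zero (fun B => hagree (.atom B) trivial a R b hab) hE
  have h1 := hcert _ _ hmod
  rw [P.localCover.mem_ext_iff fun D hD =>
    P.agreeOn fun a R b hab => hagree D (hC₀.of_mem_bodies hD) a R b hab] at h1
  exact hnot ((hI' C₀ _ hC₀ (hind ha₀)).1 h1)

/-! ### Materializability for conjunctive queries -/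

/-- `ELI`-concepts as conjunctive queries with answer variable `x`, using only the variables `x`
and `y`. -/
def Concept.toQuery : Concept → Var → Var → PEQuery
  | .atom A, x, _ => .conceptAtom A x
  | .and C D, x, y => .and (C.toQuery x y) (D.toQuery x y)
  | .ex (.name r) C, x, y => .ex y (.and (.roleAtom r x y) (C.toQuery y x))
  | .ex (.inverse r) C, x, y => .ex y (.and (.roleAtom r y x) (C.toQuery y x))
  | _, _, _ => .top

theorem Concept.isCQ_toQuery (C : Concept) (x y : Var) : (C.toQuery x y).IsCQ := by
  induction C generalizing x y with
  | and C D ihC ihD => exact ⟨ihC x y, ihD x y⟩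
  | ex R C ih => cases R <;> exact ⟨trivial, ih y x⟩
  | _ => trivial

theorem Interp.satQuery_toQuery {I : Interp} {C : Concept} (hC : C.IsELI) {x y : Var} (hxy : x ≠ y)
    (π : Var → I.dom) : I.SatQuery (C.toQuery x y) π ↔ π x ∈ I.ext C := by
  induction C generalizing x y π with
  | top => exact Iff.rfl
  | bot => exact hC.elim
  | atom A => exact Iff.rfl
  | and C D ihC ihD => exact and_congr (ihC hC.1 hxy π) (ihD hC.2 hxy π)
  | or C D => exact hC.elim
  | not C => exact hC.elim
  | all R C => exact hC.elim
  | ex R C ih =>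
    have h1 : ∀ d, I.SatQuery (C.toQuery y x) (Function.update π y d) ↔ d ∈ I.ext C := by
      intro d
      rw [ih hC hxy.symm, Function.update_self]
    cases R <;>
    · refine exists_congr fun d => and_congr ?_ (h1 d)
      simp [Interp.SatQuery, Interp.roleExt, hxy]

theorem Materializable.cq_of_peq {T : TBox} (h : Materializable .PEQ T) : Materializable .CQ T := by
  intro A hfin hne hc
  obtain ⟨I, ι, hI, hI'⟩ := h A hfin hne hc
  exact ⟨I, ι, hI, fun q a _ ha => hI' q a ha⟩

theorem Materializable.eliq_of_cq {T : TBox} (h : Materializable .CQ T) :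
    Materializable .ELIQ T := by
  intro A hfin hne hc
  obtain ⟨I, ι, hI, hI'⟩ := h A hfin hne hc
  refine ⟨I, ι, hI, fun C a hC ha => ?_⟩
  have h1 := hI' (C.toQuery 0 1) (fun _ => a) (C.isCQ_toQuery 0 1) fun _ _ => ha
  rw [Interp.satQuery_toQuery hC zero_ne_one] at h1
  rw [h1]
  exact forall₃_congr fun J κ _ => Interp.satQuery_toQuery hC zero_ne_one _

/-! ### Reinterpreting fresh role names in disjoint unions -/

/-- The role name of a possibly inverse role. -/
def Role.roleName : Role → RoleName
  | .name r => r
  | .inverse r => r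

/-- The role names in a concept. -/
def Concept.roleNames : Concept → Set RoleName
  | .top => ∅
  | .bot => ∅
  | .atom _ => ∅
  | .and C D => C.roleNames ∪ D.roleNames
  | .or C D => C.roleNames ∪ D.roleNames
  | .not C => C.roleNames
  | .ex R C => insert R.roleName C.roleNames
  | .all R C => insert R.roleName C.roleNames

/-- The role names in an axiom. -/
def TBoxAxiom.roleNames : TBoxAxiom → Set RoleName
  | .inclusion C D => C.roleNames ∪ D.roleNames
  | .func R => {R.roleName}

/-- The role names in an assertion. -/
def Assertion.roleNames {N : Type} : Assertion N → Set RoleName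
  | .concept _ _ => ∅
  | .role r _ _ => {r}

theorem Concept.roleNames_finite (C : Concept) : C.roleNames.Finite := by
  induction C with
  | top => exact Set.finite_empty
  | bot => exact Set.finite_empty
  | atom _ => exact Set.finite_empty
  | and C D ihC ihD => exact ihC.union ihD
  | or C D ihC ihD => exact ihC.union ihD
  | not C ih => exact ih
  | ex R C ih => exact ih.insert _
  | all R C ih => exact ih.insert _

theorem TBoxAxiom.roleNames_finite (φ : TBoxAxiom) : φ.roleNames.Finite := by
  cases φ with
  | inclusion C D => exact C.roleNames_finite.union D.roleNames_finite
  | func R => exact Set.finite_singleton _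

theorem Assertion.roleNames_finite {N : Type} (φ : Assertion N) : φ.roleNames.Finite := by
  cases φ with
  | concept A a => exact Set.finite_empty
  | role r a b => exact Set.finite_singleton _

/-- The disjoint union of interpretations in which the role names from `F` are interpreted by
`E`. -/
def Interp.sum {X : Type} [Nonempty X] (K : X → Interp) (F : Set RoleName)
    (E : RoleName → (Σ x, (K x).dom) → (Σ x, (K x).dom) → Prop) : Interp where
  dom := Σ x, (K x).dom
  dom_nonempty := ‹Nonempty X›.elim fun x => (K x).dom_nonempty.elim fun d => ⟨⟨x, d⟩⟩
  concept A := {p | p.2 ∈ (K p.1).concept A}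
  role r p q := (r ∉ F ∧ ∃ x d e, p = ⟨x, d⟩ ∧ q = ⟨x, e⟩ ∧ (K x).role r d e) ∨ (r ∈ F ∧ E r p q)

section Sum

variable {X : Type} [Nonempty X] {K : X → Interp} {F : Set RoleName}
  {E : RoleName → (Σ x, (K x).dom) → (Σ x, (K x).dom) → Prop}

theorem Interp.roleExt_sum {R : Role} (hR : R.roleName ∉ F) {x : X} {d : (K x).dom}
    {q : (Interp.sum K F E).dom} :
    (Interp.sum K F E).roleExt R (⟨x, d⟩ : Σ x, (K x).dom) q ↔
      ∃ e, q = (⟨x, e⟩ : Σ x, (K x).dom) ∧ (K x).roleExt R d e := by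
  cases R with
  | name r =>
    constructor
    · rintro (⟨-, y, d', e, h1, rfl, h⟩ | ⟨h, -⟩)
      · cases h1
        exact ⟨e, rfl, h⟩
      · exact (hR h).elim
    · rintro ⟨e, rfl, h⟩
      exact Or.inl ⟨hR, x, d, e, rfl, rfl, h⟩
  | inverse r =>
    constructor
    · rintro (⟨-, y, d', e, rfl, h1, h⟩ | ⟨h, -⟩)
      · cases h1
        exact ⟨d', rfl, h⟩
      · exact (hR h).elim
    · rintro ⟨e, rfl, h⟩
      exact Or.inl ⟨hR, x, e, d, rfl, rfl, h⟩

theorem Interp.mem_ext_sum {C : Concept} (hC : Disjoint C.roleNames F) {x : X} {d : (K x).dom} :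
    (⟨x, d⟩ : Σ x, (K x).dom) ∈ (Interp.sum K F E).ext C ↔ d ∈ (K x).ext C := by
  induction C generalizing d with
  | top => exact Iff.rfl
  | bot => exact Iff.rfl
  | atom A => exact Iff.rfl
  | and C D ihC ihD =>
    obtain ⟨h1, h2⟩ := Set.disjoint_union_left.1 hC
    exact and_congr (ihC h1) (ihD h2)
  | or C D ihC ihD =>
    obtain ⟨h1, h2⟩ := Set.disjoint_union_left.1 hC
    exact or_congr (ihC h1) (ihD h2)
  | not C ih => exact not_congr (ih hC)
  | ex R C ih =>
    obtain ⟨h1, h2⟩ := Set.disjoint_insert_left.1 hC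
    constructor
    · rintro ⟨q, hq, hqC⟩
      obtain ⟨e, rfl, he⟩ := (Interp.roleExt_sum h1).1 hq
      exact ⟨e, he, (ih h2).1 hqC⟩
    · rintro ⟨e, he, heC⟩
      exact ⟨_, (Interp.roleExt_sum h1).2 ⟨e, rfl, he⟩, (ih h2).2 heC⟩
  | all R C ih =>
    obtain ⟨h1, h2⟩ := Set.disjoint_insert_left.1 hC
    constructor
    · intro h e he
      exact (ih h2).1 (h _ ((Interp.roleExt_sum h1).2 ⟨e, rfl, he⟩))
    · intro h q hq
      obtain ⟨e, rfl, he⟩ := (Interp.roleExt_sum h1).1 hq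
      exact (ih h2).2 (h e he)

/-- The axioms do not mention the role names in `F`, so they see only the separate components, and
`E` may be arbitrary. -/
theorem Interp.satAxiom_sum {φ : TBoxAxiom} (hφ : Disjoint φ.roleNames F)
    (h : ∀ x, (K x).SatAxiom φ) : (Interp.sum K F E).SatAxiom φ := by
  cases φ with
  | inclusion C D =>
    obtain ⟨h1, h2⟩ := Set.disjoint_union_left.1 hφ
    rintro ⟨x, d⟩ hd
    exact (Interp.mem_ext_sum h2).2 (h x ((Interp.mem_ext_sum h1).1 hd))
  | func R =>
    have hR : R.roleName ∉ F := Set.disjoint_singleton_left.1 hφ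
    rintro ⟨x, d⟩ q q' hq hq'
    obtain ⟨e, rfl, he⟩ := (Interp.roleExt_sum hR).1 hq
    obtain ⟨e', rfl, he'⟩ := (Interp.roleExt_sum hR).1 hq'
    rw [h x d e e' he he']

end Sum

/-! ### Finite witnesses for `ELI`-concepts -/

/-- Membership in an ELI-concept uses only finitely many positive facts about chosen witnesses. Any
map preserving these facts, injective or not, preserves the membership. -/
theorem Interp.exists_finite_abox (I : Interp) {C : Concept} (hC : C.IsELI) {d : I.dom}
    (hd : d ∈ I.ext C) : ∃ D : ABox I.dom, D.Finite ∧ (∀ φ ∈ D, I.SatAssertion id φ) ∧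
      ∀ (K : Interp) (κ : I.dom → K.dom), (∀ φ ∈ D, K.SatAssertion κ φ) → κ d ∈ K.ext C := by
  induction C generalizing d with
  | top => exact ⟨∅, Set.finite_empty, fun _ h => h.elim, fun _ _ _ => trivial⟩
  | bot => exact hC.elim
  | atom A =>
    refine ⟨{.concept A d}, Set.finite_singleton _, ?_, fun K κ h => h (.concept A d) rfl⟩
    rintro _ rfl
    exact hd
  | and C D ihC ihD =>
    obtain ⟨B, hB1, hB2, hB3⟩ := ihC hC.1 hd.1
    obtain ⟨B', hB1', hB2', hB3'⟩ := ihD hC.2 hd.2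
    refine ⟨B ∪ B', hB1.union hB1', ?_, fun K κ h => ⟨hB3 K κ fun φ hφ => h φ (Or.inl hφ),
      hB3' K κ fun φ hφ => h φ (Or.inr hφ)⟩⟩
    rintro φ (hφ | hφ)
    · exact hB2 φ hφ
    · exact hB2' φ hφ
  | or C D => exact hC.elim
  | not C => exact hC.elim
  | all R C => exact hC.elim
  | ex R C ih =>
    obtain ⟨e, he, heC⟩ := hd
    obtain ⟨B, hB1, hB2, hB3⟩ := ih hC heC
    refine ⟨insert (R.assertion d e) B, hB1.insert _, ?_, fun K κ h =>
      ⟨κ e, ?_, hB3 K κ fun φ hφ => h φ (Or.inr hφ)⟩⟩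
    · rintro φ (rfl | hφ)
      · cases R <;> exact he
      · exact hB2 φ hφ
    · have := h _ (Or.inl rfl)
      cases R <;> exact this

/-! ### Twisted products -/

/-- A covering of an ABox with sheets `ι`, where role assertions may connect different sheets. -/
def ABox.twist {N ι : Type} (A : ABox N) (τ : N → N → Equiv.Perm ι) : ABox (N × ι) :=
  {φ | (∃ B x i, Assertion.concept B x ∈ A ∧ φ = .concept B (x, i)) ∨
    ∃ r x y i, Assertion.role r x y ∈ A ∧ φ = .role r (x, i) (y, τ x y i)}

theorem ABox.fst_mem_ind_of_mem_ind_twist {N ι : Type} {A : ABox N} {τ : N → N → Equiv.Perm ι}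
    {x : N × ι} (hx : x ∈ (A.twist τ).Ind) : x.1 ∈ A.Ind := by
  obtain ⟨φ, ⟨B, y, i, h, rfl⟩ | ⟨r, y, z, i, h, rfl⟩, hφ⟩ := hx
  · obtain rfl : x = (y, i) := hφ
    exact ⟨_, h, rfl⟩
  · rcases hφ with hφ | hφ
    · obtain rfl : x = (y, i) := hφ
      exact ⟨_, h, Or.inl rfl⟩
    · obtain rfl : x = (z, _) := hφ
      exact ⟨_, h, Or.inr rfl⟩

theorem ABox.mem_ind_twist {N ι : Type} {A : ABox N} (τ : N → N → Equiv.Perm ι) {a : N}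
    (ha : a ∈ A.Ind) (i : ι) : (a, i) ∈ (A.twist τ).Ind := by
  obtain ⟨φ, hφ, ha⟩ := ha
  cases φ with
  | concept B b =>
    obtain rfl : a = b := ha
    exact ⟨_, Or.inl ⟨B, a, i, hφ, rfl⟩, rfl⟩
  | role r b c =>
    rcases ha with ha | ha
    · obtain rfl : a = b := ha
      exact ⟨_, Or.inr ⟨r, a, c, i, hφ, rfl⟩, Or.inl rfl⟩
    · obtain rfl : a = c := ha
      refine ⟨_, Or.inr ⟨r, b, a, (τ b a).symm i, hφ, rfl⟩, Or.inr ?_⟩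
      rw [Equiv.apply_symm_apply]
      rfl

/-- Since the sheets change by permutations, edges lift in both directions. -/
theorem ABox.lifts_twist {N ι : Type} (A : ABox N) (τ : N → N → Equiv.Perm ι) :
    Lifts Prod.fst (A.twist τ) A where
  concept C x _ h := Or.inl ⟨C, x.1, x.2, h, rfl⟩
  role R x b _ h := by
    cases R with
    | name r => exact ⟨(b, τ x.1 b x.2), Or.inr ⟨r, x.1, b, x.2, h, rfl⟩, rfl⟩
    | inverse r =>
      refine ⟨(b, (τ b x.1).symm x.2), Or.inr ⟨r, b, x.1, (τ b x.1).symm x.2, h, ?_⟩, rfl⟩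
      rw [Equiv.apply_symm_apply]

theorem ABox.hasRole_image {M N : Type} {g : M → N} {A : ABox M} {R : Role} {a b : N}
    (h : ABox.HasRole (Assertion.map g '' A) R a b) :
    ∃ a' b', A.HasRole R a' b' ∧ g a' = a ∧ g b' = b := by
  cases R with
  | name r =>
    obtain ⟨φ, hφ, h⟩ := h
    cases φ with
    | concept => cases h
    | role r' a' b' =>
      cases h
      exact ⟨a', b', hφ, rfl, rfl⟩
  | inverse r =>
    obtain ⟨φ, hφ, h⟩ := h
    cases φ with
    | concept => cases h
    | role r' a' b' =>
      cases h
      exact ⟨b', a', hφ, rfl, rfl⟩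

theorem Lifts.image {L M N : Type} {f : L → M} {B : ABox L} {A : ABox M} (h : Lifts f B A)
    (hind : ∀ x ∈ B.Ind, f x ∈ A.Ind) {g : M → N} (hg : Set.InjOn g A.Ind) :
    Lifts (g ∘ f) B (Assertion.map g '' A) where
  concept C x hx hC := by
    obtain ⟨φ, hφ, hC⟩ := hC
    cases φ with
    | role => cases hC
    | concept C' a =>
      injection hC with h1 h2
      subst h1
      obtain rfl := hg ⟨_, hφ, rfl⟩ (hind x hx) h2
      exact h.concept _ x hx hφ
  role R x b hx hR := by
    obtain ⟨a', b', h1, h2, rfl⟩ := ABox.hasRole_image hR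
    obtain rfl := hg (ABox.mem_ind_of_hasRole h1).1 (hind x hx) h2
    obtain ⟨y, hy, rfl⟩ := h.role R x b' hx h1
    exact ⟨y, hy, rfl⟩

/-- For unraveling tolerant TBoxes, certain answers are preserved in coverings. -/
theorem UnravelingTolerant.certainConcept_of_lifts {T : TBox} (hT : UnravelingTolerant T)
    {M N : Type} {f : M → N} {B : ABox M} {A : ABox N} (hA : A.Finite) (h : Lifts f B A)
    (hind : ∀ x ∈ B.Ind, f x ∈ A.Ind) (hsurj : ∀ a ∈ A.Ind, ∃ x ∈ B.Ind, f x = a)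
    {x : M} (hx : x ∈ B.Ind) {C : Concept} (hC : C.IsELI) (hcert : CertainConcept T A C (f x)) :
    CertainConcept T B C x := by
  classical
  obtain ⟨g, hg⟩ := ABox.exists_injOn_ind hA
  have : Nonempty M := ⟨x⟩
  have h1 : ∀ b, ∃ y, b ∈ ABox.Ind (Assertion.map g '' A) → y ∈ B.Ind ∧ g (f y) = b := by
    intro b
    by_cases hb : b ∈ ABox.Ind (Assertion.map g '' A)
    · have hb' := hb
      rw [ABox.ind_image] at hb'
      obtain ⟨a, ha, rfl⟩ := hb'
      obtain ⟨y, hy, rfl⟩ := hsurj a ha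
      exact ⟨y, fun _ => ⟨hy, rfl⟩⟩
    · exact ⟨x, fun h => (hb h).elim⟩
  choose s hs using h1
  have hs' : ∀ b ∈ ABox.Ind (Assertion.map g '' A), Function.update s (g (f x)) x b ∈ B.Ind ∧
      (g ∘ f) (Function.update s (g (f x)) x b) = b := by
    intro b hb
    by_cases hbx : b = g (f x)
    · subst hbx
      rw [Function.update_self]
      exact ⟨hx, rfl⟩
    · rw [Function.update_of_ne hbx]
      exact hs b hb
  have hmem : g (f x) ∈ ABox.Ind (Assertion.map g '' A) := by
    rw [ABox.ind_image]
    exact ⟨_, hind x hx, rfl⟩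
  have hne : A.Nonempty := by
    obtain ⟨φ, hφ, -⟩ := hind x hx
    exact ⟨φ, hφ⟩
  have h2 := hT _ (hA.image _) (hne.image _) C _ hC hmem
    ((certainConcept_image_iff hg (hind x hx)).2 hcert)
  have h3 := h2.of_unravel (h.image hind hg) hs'
  rwa [Path.lift_start, Function.update_self] at h3

/-! ### Unraveling tolerant TBoxes have the disjunction property -/

/-- `ELI`-queries that are not certain but satisfiable, with the models that witness this, and
fresh role names `first` and `second i`. -/
structure DisjunctionData (T : TBox) (A : ABox IndName) (ι : Type) where
  C : ι → Concept
  eli : ∀ i, (C i).IsELI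
  a : ι → IndName
  mem_ind : ∀ i, a i ∈ A.Ind
  I : ι → Interp
  κ : ∀ i, IndName → (I i).dom
  isModel : ∀ i, IsModel T A (I i) (κ i)
  notMem : ∀ i, κ i (a i) ∉ (I i).ext (C i)
  L : ι → Interp
  tbox : ∀ i, ∀ φ ∈ T, (L i).SatAxiom φ
  l : ∀ i, (L i).dom
  D : ∀ i, ABox (L i).dom
  finite : ∀ i, (D i).Finite
  sat : ∀ i, ∀ φ ∈ D i, (L i).SatAssertion id φ
  mem_ext : ∀ i (K : Interp) (μ : (L i).dom → K.dom), (∀ φ ∈ D i, K.SatAssertion μ φ) →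
    μ (l i) ∈ K.ext (C i)
  first : RoleName
  second : ι → RoleName
  second_injective : Function.Injective second
  fresh_tbox : ∀ φ ∈ T, Disjoint φ.roleNames (insert first (Set.range second))
  fresh_concept : ∀ i, Disjoint (C i).roleNames (insert first (Set.range second))
  fresh_abox : ∀ r x y, Assertion.role r x y ∈ A → r ∉ insert first (Set.range second)
  fresh_witness : ∀ i r x y, Assertion.role r x y ∈ D i → r ∉ insert first (Set.range second)

/-- The individuals of the ABox that combines the disjuncts. -/
inductive Gadget (ι : Type) (W : ι → Type) : Type
  | ind (b : IndName)
  | root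
  | mid (j : ι)
  | wit (i : ι) (w : W i)

/-- The components of the countermodel. -/
inductive Part (ι : Type) : Type
  | base
  | root
  | mid (j : ι)
  | wit (i : ι)

namespace DisjunctionData

variable {T : TBox} {A : ABox IndName} {ι : Type} (S : DisjunctionData T A ι)

/-- The fresh role names. -/
def fresh : Set RoleName := insert S.first (Set.range S.second)

theorem first_mem_fresh : S.first ∈ S.fresh := Or.inl rfl

theorem second_mem_fresh (i : ι) : S.second i ∈ S.fresh := Or.inr ⟨i, rfl⟩

/-- The individuals of the combined ABox. -/
abbrev Node : Type := Gadget ι fun i => (S.L i).dom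

/-- The ABox `A` together with a root whose `j`-th successor is connected to `a j` and to
witnesses for all concepts `C i` with `i ≠ j`. -/
inductive Mem : Assertion S.Node → Prop
  | indConcept (B : ConceptName) (b : IndName) (h : .concept B b ∈ A) : Mem (.concept B (.ind b))
  | indRole (r : RoleName) (b c : IndName) (h : .role r b c ∈ A) : Mem (.role r (.ind b) (.ind c))
  | witConcept (i : ι) (B : ConceptName) (w : (S.L i).dom) (h : .concept B w ∈ S.D i) :
      Mem (.concept B (.wit i w))
  | witRole (i : ι) (r : RoleName) (w v : (S.L i).dom) (h : .role r w v ∈ S.D i) :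
      Mem (.role r (.wit i w) (.wit i v))
  | first (r : RoleName) (j : ι) (hr : r = S.first) : Mem (.role r .root (.mid j))
  | second (r : RoleName) (j : ι) (b : IndName) (hr : r = S.second j) (hb : b = S.a j) :
      Mem (.role r (.mid j) (.ind b))
  | other (r : RoleName) (j i : ι) (w : (S.L i).dom) (h : i ≠ j) (hr : r = S.second i)
      (hw : w = S.l i) : Mem (.role r (.mid j) (.wit i w))

/-- The combined ABox. -/
def abox : ABox S.Node := {φ | S.Mem φ}

theorem abox_finite [Finite ι] (hA : A.Finite) : S.abox.Finite := by
  refine ((hA.image (Assertion.map Gadget.ind)).union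
    ((Set.finite_iUnion fun i => (S.finite i).image (Assertion.map (Gadget.wit i))).union
    ((Set.finite_range fun j => Assertion.role S.first .root (.mid j)).union
    ((Set.finite_range fun j => Assertion.role (S.second j) (.mid j) (.ind (S.a j))).union
    (Set.finite_range fun p : ι × ι =>
      Assertion.role (S.second p.2) (.mid p.1) (.wit p.2 (S.l p.2))))))).subset ?_
  intro φ hφ
  cases hφ with
  | indConcept B b h => exact Or.inl ⟨_, h, rfl⟩
  | indRole r b c h => exact Or.inl ⟨_, h, rfl⟩
  | witConcept i B w h => exact Or.inr (Or.inl (Set.mem_iUnion.2 ⟨i, _, h, rfl⟩))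
  | witRole i r w v h => exact Or.inr (Or.inl (Set.mem_iUnion.2 ⟨i, _, h, rfl⟩))
  | first r j hr => exact Or.inr (Or.inr (Or.inl ⟨j, by rw [hr]⟩))
  | second r j b hr hb => exact Or.inr (Or.inr (Or.inr (Or.inl ⟨j, by rw [hr, hb]⟩)))
  | other r j i w h hr hw => exact Or.inr (Or.inr (Or.inr (Or.inr ⟨(j, i), by rw [hr, hw]⟩)))

theorem ind_mem_ind_abox {b : IndName} : Gadget.ind b ∈ S.abox.Ind ↔ b ∈ A.Ind := by
  constructor
  · rintro ⟨φ, hφ, hb⟩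
    cases hφ with
    | indConcept B c h =>
      cases hb
      exact ⟨_, h, rfl⟩
    | indRole r c d h =>
      rcases hb with hb | hb
      · cases hb
        exact ⟨_, h, Or.inl rfl⟩
      · cases hb
        exact ⟨_, h, Or.inr rfl⟩
    | witConcept i B w h => cases hb
    | witRole i r w v h => rcases hb with hb | hb <;> cases hb
    | first r j hr => rcases hb with hb | hb <;> cases hb
    | second r j c hr hc =>
      rcases hb with hb | hb
      · cases hb
      · cases hb
        rw [hc]
        exact S.mem_ind j
    | other r j i w h hr hw => rcases hb with hb | hb <;> cases hb
  · rintro ⟨φ, hφ, hb⟩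
    cases φ with
    | concept B c => exact ⟨_, Mem.indConcept B c hφ, congrArg Gadget.ind hb⟩
    | role r c d =>
      refine ⟨_, Mem.indRole r c d hφ, ?_⟩
      rcases hb with hb | hb
      · exact Or.inl (congrArg Gadget.ind hb)
      · exact Or.inr (congrArg Gadget.ind hb)

/-- The query that says that some successor of the root is connected to instances of all the
concepts. -/
noncomputable def query [Fintype ι] : Concept :=
  .ex (.name S.first) (.conj (Finset.univ.toList.map fun i => .ex (.name (S.second i)) (S.C i)))

theorem isELI_query [Fintype ι] : S.query.IsELI := by
  refine Concept.isELI_conj fun D hD => ?_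
  obtain ⟨i, -, rfl⟩ := List.mem_map.1 hD
  exact S.eli i

theorem mem_ext_query [Fintype ι] {K : Interp} {d : K.dom} :
    d ∈ K.ext S.query ↔ ∃ e, K.role S.first d e ∧ ∀ i, ∃ e', K.role (S.second i) e e' ∧
      e' ∈ K.ext (S.C i) := by
  refine exists_congr fun e => and_congr Iff.rfl ?_
  rw [Interp.mem_ext_conj]
  constructor
  · intro h i
    exact h _ (List.mem_map.2 ⟨i, Finset.mem_toList.2 (Finset.mem_univ i), rfl⟩)
  · intro h D hD
    obtain ⟨i, -, rfl⟩ := List.mem_map.1 hD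
    exact h i

/-- If `C j` holds at `a j`, then the `j`-th successor of the root witnesses the query: its `second
j`-edge leads to `a j`, and the other conjuncts are provided by the attached witnesses. -/
theorem certainConcept_query [Fintype ι]
    (h : ∀ (I : Interp) (κ : IndName → I.dom), IsModel T A I κ → ∃ i, κ (S.a i) ∈ I.ext (S.C i)) :
    CertainConcept T S.abox S.query .root := by
  intro K κ hK
  have hmod : IsModel T A K fun b => κ (.ind b) :=
    { tbox := hK.tbox
      standardNames := by
        intro b hb c hc hbc
        have := hK.standardNames (S.ind_mem_ind_abox.2 hb) (S.ind_mem_ind_abox.2 hc) hbc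
        injection this
      abox := by
        intro φ hφ
        cases φ with
        | concept B b => exact hK.abox _ (Mem.indConcept B b hφ)
        | role r b c => exact hK.abox _ (Mem.indRole r b c hφ) }
  obtain ⟨j, hj⟩ := h K _ hmod
  refine S.mem_ext_query.2 ⟨κ (.mid j), hK.abox _ (Mem.first _ j rfl), fun i => ?_⟩
  by_cases hij : i = j
  · subst hij
    exact ⟨_, hK.abox _ (Mem.second _ i _ rfl rfl), hj⟩
  · refine ⟨_, hK.abox _ (Mem.other _ j i _ hij rfl rfl),
      S.mem_ext i K (fun w => κ (.wit i w)) fun φ hφ => ?_⟩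
    cases φ with
    | concept B w => exact hK.abox _ (Mem.witConcept i B w hφ)
    | role r w v => exact hK.abox _ (Mem.witRole i r w v hφ)

/-! ### The twisted covering and its countermodel -/

open Classical in
/-- The edge from the `j`-th successor of the root to `a j` leads from the sheet `i₀` to the
sheet `j`. -/
noncomputable def sheet (i₀ : ι) : S.Node → S.Node → Equiv.Perm ι
  | .mid j, .ind _ => Equiv.swap i₀ j
  | _, _ => 1

/-- The components of the countermodel. -/
def comp : Part ι × ι → Interp
  | (.wit i, _) => S.L i
  | (_, i) => S.I i

/-- The individuals as elements of the components. -/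
def place : S.Node × ι → Σ x, (S.comp x).dom
  | (.ind b, i) => ⟨(.base, i), S.κ i b⟩
  -- The root and its successors take part in fresh roles only and have no concept assertions, so
  -- any element of a component of their own will do; `S.κ i 0` is merely an available one.
  | (.root, i) => ⟨(.root, i), S.κ i 0⟩
  | (.mid j, i) => ⟨(.mid j, i), S.κ i 0⟩
  | (.wit j w, i) => ⟨(.wit j, i), w⟩

theorem place_eq_ind {x : S.Node × ι} {b : IndName} {i : ι}
    (h : S.place x = S.place (.ind b, i)) : ∃ c, x = (.ind c, i) ∧ S.κ i c = S.κ i b := by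
  obtain ⟨x, i'⟩ := x
  cases x with
  | ind c =>
    have h1 : (Part.base, i') = (Part.base, i) := congrArg Sigma.fst h
    cases h1
    exact ⟨c, rfl, eq_of_heq (Sigma.mk.inj h).2⟩
  | root => cases congrArg (fun p => p.1.1) h
  | mid j => cases congrArg (fun p => p.1.1) h
  | wit j w => cases congrArg (fun p => p.1.1) h

theorem place_eq_root {x : S.Node × ι} {i : ι}
    (h : S.place x = S.place (.root, i)) : x = (.root, i) := by
  obtain ⟨x, i'⟩ := x
  cases x with
  | ind c => cases congrArg (fun p => p.1.1) h
  | root =>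
    have h1 : (Part.root, i') = (Part.root, i) := congrArg Sigma.fst h
    cases h1
    rfl
  | mid j => cases congrArg (fun p => p.1.1) h
  | wit j w => cases congrArg (fun p => p.1.1) h

theorem place_eq_mid {x : S.Node × ι} {j i : ι}
    (h : S.place x = S.place (.mid j, i)) : x = (.mid j, i) := by
  obtain ⟨x, i'⟩ := x
  cases x with
  | ind c => cases congrArg (fun p => p.1.1) h
  | root => cases congrArg (fun p => p.1.1) h
  | mid j' =>
    have h1 : (Part.mid j', i') = (Part.mid j, i) := congrArg Sigma.fst h
    cases h1
    rfl
  | wit j w => cases congrArg (fun p => p.1.1) h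

theorem place_eq_wit {x : S.Node × ι} {j : ι} {w : (S.L j).dom} {i : ι}
    (h : S.place x = S.place (.wit j w, i)) : x = (.wit j w, i) := by
  obtain ⟨x, i'⟩ := x
  cases x with
  | ind c => cases congrArg (fun p => p.1.1) h
  | root => cases congrArg (fun p => p.1.1) h
  | mid j => cases congrArg (fun p => p.1.1) h
  | wit j' w' =>
    have h1 : (Part.wit j', i') = (Part.wit j, i) := congrArg Sigma.fst h
    cases h1
    have h2 : w' = w := eq_of_heq (Sigma.mk.inj h).2
    rw [h2]

/-- The disjoint union of the components, connected by the fresh roles. -/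
noncomputable def countermodel (i₀ : ι) : Interp :=
  have : Nonempty (Part ι × ι) := ⟨(.base, i₀)⟩
  Interp.sum S.comp S.fresh fun r p q => ∃ u v, Assertion.role r u v ∈ S.abox.twist (S.sheet i₀) ∧
    p = S.place u ∧ q = S.place v

theorem satAxiom_comp {φ : TBoxAxiom} (hφ : φ ∈ T) (x : Part ι × ι) : (S.comp x).SatAxiom φ := by
  obtain ⟨x, i⟩ := x
  cases x with
  | wit j => exact S.tbox j φ hφ
  | _ => exact (S.isModel i).tbox φ hφ

/-- On sheet `i` the copy of `A` lies in the model `S.I i`, and every witness ABox lies in its own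
model. Edges between components carry fresh roles only, to which the TBox is blind. -/
theorem isModel_countermodel (i₀ : ι) :
    IsModel T (S.abox.twist (S.sheet i₀)) (S.countermodel i₀) S.place := by
  have : Nonempty (Part ι × ι) := ⟨(.base, i₀)⟩
  refine ⟨fun φ hφ => Interp.satAxiom_sum (S.fresh_tbox φ hφ) (S.satAxiom_comp hφ), ?_, ?_⟩
  · rintro x hx ⟨y, i⟩ hy h
    cases y with
    | ind b =>
      obtain ⟨c, rfl, hc⟩ := S.place_eq_ind h
      have h1 := S.ind_mem_ind_abox.1 (ABox.fst_mem_ind_of_mem_ind_twist hx)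
      have h2 := S.ind_mem_ind_abox.1 (ABox.fst_mem_ind_of_mem_ind_twist hy)
      rw [(S.isModel i).standardNames h1 h2 hc]
    | root => exact S.place_eq_root h
    | mid j => exact S.place_eq_mid h
    | wit j w => exact S.place_eq_wit h
  · intro φ hφ
    have hφ' := hφ
    have hE : ∀ r u v, Assertion.role r u v ∈ S.abox.twist (S.sheet i₀) → r ∈ S.fresh →
        (S.countermodel i₀).role r (S.place u) (S.place v) := fun r u v h hr =>
      Or.inr ⟨hr, u, v, h, rfl, rfl⟩
    rcases hφ with ⟨B, x, i, h, rfl⟩ | ⟨r, x, y, i, h, rfl⟩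
    · cases h with
      | indConcept _ b h => exact (S.isModel i).abox _ h
      | witConcept j _ w h => exact S.sat j _ h
    · cases h with
      | indRole _ b c h =>
        exact Or.inl ⟨S.fresh_abox _ _ _ h, _, _, _, rfl, rfl, (S.isModel i).abox _ h⟩
      | witRole j _ w v h =>
        exact Or.inl ⟨S.fresh_witness j _ _ _ h, (.wit j, i), _, _, rfl, rfl, S.sat j _ h⟩
      | first _ j hr => exact hE r _ _ hφ' (hr ▸ S.first_mem_fresh)
      | second _ j b hr hb => exact hE r _ _ hφ' (hr ▸ S.second_mem_fresh j)
      | other _ j j' w h hr hw => exact hE r _ _ hφ' (hr ▸ S.second_mem_fresh j')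

theorem role_countermodel {i₀ : ι} {r : RoleName} (hr : r ∈ S.fresh)
    {p q : (S.countermodel i₀).dom} (h : (S.countermodel i₀).role r p q) :
    ∃ x y i, S.Mem (.role r x y) ∧ S.place (x, i) = p ∧ q = S.place (y, S.sheet i₀ x y i) := by
  rcases h with ⟨h, -⟩ | ⟨-, u, v, h, rfl, rfl⟩
  · exact (h hr).elim
  · rcases h with ⟨B, x, i, h, h'⟩ | ⟨r', x, y, i, h, h'⟩
    · cases h'
    · cases h'
      exact ⟨x, y, i, h, rfl, rfl⟩

/-- From the root on sheet `i₀`, each `first`-successor is some `mid j` on the same sheet. Its only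
`second j`-successor is `a j` on sheet `j`, where `S.I j` refutes `C j`. -/
theorem notMem_ext_query [Fintype ι] (i₀ : ι) :
    S.place (.root, i₀) ∉ (S.countermodel i₀).ext S.query := by
  have : Nonempty (Part ι × ι) := ⟨(.base, i₀)⟩
  intro h
  obtain ⟨e, he, hall⟩ := S.mem_ext_query.1 h
  obtain ⟨x, y, i, hm, hx, rfl⟩ := S.role_countermodel S.first_mem_fresh he
  cases S.place_eq_root hx
  cases hm with
  | first _ j hr =>
    obtain ⟨e', he', heC⟩ := hall j
    obtain ⟨x, z, i, hm, hx, rfl⟩ := S.role_countermodel (S.second_mem_fresh j) he'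
    cases S.place_eq_mid hx
    cases hm with
    | second _ _ b hr hb =>
      subst hb
      -- The edge from the root stays on sheet `i₀`; the swap then carries `i₀` to `j`.
      have h1 : S.sheet i₀ (.mid j) (.ind (S.a j)) ((S.sheet i₀ .root (.mid j)) i₀) = j := by
        classical
        exact Equiv.swap_apply_left i₀ j
      rw [h1] at heC
      exact S.notMem j ((Interp.mem_ext_sum (K := S.comp) (x := (Part.base, j))
        (S.fresh_concept j)).1 heC)
    | other _ _ i' w h hr hw => exact h (S.second_injective hr).symm

end DisjunctionData

theorem UnravelingTolerant.disjunctionData {T : TBox} (hT : UnravelingTolerant T)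
    {A : ABox IndName} (hA : A.Finite) {ι : Type} [Finite ι] [Nonempty ι]
    (S : DisjunctionData T A ι) :
    ∃ (I : Interp) (κ : IndName → I.dom), IsModel T A I κ ∧ ∀ i, κ (S.a i) ∉ I.ext (S.C i) := by
  by_contra hcon
  push Not at hcon
  have := Fintype.ofFinite ι
  obtain ⟨i₀⟩ := ‹Nonempty ι›
  have hroot : Gadget.root ∈ S.abox.Ind := ⟨_, DisjunctionData.Mem.first _ i₀ rfl, Or.inl rfl⟩
  exact S.notMem_ext_query i₀ (hT.certainConcept_of_lifts (S.abox_finite hA)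
    (S.abox.lifts_twist (S.sheet i₀)) (fun _ => ABox.fst_mem_ind_of_mem_ind_twist)
    (fun x hx => ⟨(x, i₀), ABox.mem_ind_twist _ hx i₀, rfl⟩) (ABox.mem_ind_twist _ hroot i₀)
    S.isELI_query (S.certainConcept_query hcon) _ _ (S.isModel_countermodel i₀))

/-- In unraveling tolerant TBoxes, finitely many `ELI`-queries none of which is certain are
falsified simultaneously in some model. -/
theorem UnravelingTolerant.exists_isModel_forall_notMem {T : TBox} (hT : UnravelingTolerant T)
    {A : ABox IndName} (hA : A.Finite) (hc : Consistent T A) (F : Set (Concept × IndName))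
    (hF : F.Finite) (heli : ∀ p ∈ F, p.1.IsELI ∧ p.2 ∈ A.Ind ∧ ¬CertainConcept T A p.1 p.2) :
    ∃ (I : Interp) (κ : IndName → I.dom), IsModel T A I κ ∧ ∀ p ∈ F, κ p.2 ∉ I.ext p.1 := by
  -- Queries unsatisfiable with respect to `T` fail in every model and offer no witness ABox, so
  -- they are set aside.
  let G : Set (Concept × IndName) :=
    {p | p ∈ F ∧ ∃ (L : Interp) (l : L.dom), (∀ φ ∈ T, L.SatAxiom φ) ∧ l ∈ L.ext p.1}
  have hGF : G ⊆ F := fun p hp => hp.1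
  have hG : G.Finite := hF.subset hGF
  suffices h : ∃ (I : Interp) (κ : IndName → I.dom), IsModel T A I κ ∧
      ∀ p ∈ G, κ p.2 ∉ I.ext p.1 by
    obtain ⟨I, κ, hI, hIG⟩ := h
    exact ⟨I, κ, hI, fun p hp hmem => hIG p ⟨hp, I, _, hI.tbox, hmem⟩ hmem⟩
  by_cases hne : Nonempty G
  swap
  · obtain ⟨I, κ, hI⟩ := hc
    exact ⟨I, κ, hI, fun p hp => (hne ⟨⟨p, hp⟩⟩).elim⟩
  have : Finite G := hG.to_subtype
  have h1 : ∀ p : G, ∃ (I : Interp) (κ : IndName → I.dom), IsModel T A I κ ∧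
      κ p.1.2 ∉ I.ext p.1.1 := by
    intro p
    have := (heli p.1 p.2.1).2.2
    unfold CertainConcept at this
    push Not at this
    obtain ⟨I, κ, h⟩ := this
    exact ⟨I, κ, h⟩
  choose I κ hI hnot using h1
  choose L l hL hl using fun p : G => p.2.2
  choose D hD1 hD2 hD3 using fun p : G =>
    (L p).exists_finite_abox (heli p.1 p.2.1).1 (hl p)
  let N : Set RoleName := (⋃ φ ∈ T, φ.roleNames) ∪ ((⋃ φ ∈ A, φ.roleNames) ∪
    ((⋃ p : G, p.1.1.roleNames) ∪ ⋃ p : G, ⋃ φ ∈ D p, φ.roleNames))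
  have hN : N.Finite := by
    refine Set.Finite.union ?_ (Set.Finite.union ?_ (Set.Finite.union ?_ ?_))
    · exact T.finite_toSet.biUnion fun φ _ => φ.roleNames_finite
    · exact hA.biUnion fun φ _ => φ.roleNames_finite
    · exact Set.finite_iUnion fun p => p.1.1.roleNames_finite
    · exact Set.finite_iUnion fun p => (hD1 p).biUnion fun φ _ => φ.roleNames_finite
  obtain ⟨f, hf⟩ := exists_injective_nat (Option G)
  -- Fresh role names are drawn from the infinite complement of `N`: `none` yields `first`, and
  -- `some p` yields `second p`.
  let ρ : Option G → RoleName := fun o => (hN.infinite_compl.natEmbedding Nᶜ (f o)).1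
  have hρ : Function.Injective ρ := fun o o' h =>
    hf ((hN.infinite_compl.natEmbedding Nᶜ).injective (Subtype.ext h))
  have hρN : ∀ o, ρ o ∉ N := fun o => (hN.infinite_compl.natEmbedding Nᶜ (f o)).2
  have hfresh : ∀ r ∈ N, r ∉ insert (ρ none) (Set.range fun p => ρ (some p)) := by
    rintro r hr (rfl | ⟨p, rfl⟩)
    · exact hρN _ hr
    · exact hρN _ hr
  let S : DisjunctionData T A G :=
    { C := fun p => p.1.1
      eli := fun p => (heli p.1 p.2.1).1
      a := fun p => p.1.2
      mem_ind := fun p => (heli p.1 p.2.1).2.1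
      I := I
      κ := κ
      isModel := hI
      notMem := hnot
      L := L
      tbox := hL
      l := l
      D := D
      finite := hD1
      sat := hD2
      mem_ext := hD3
      first := ρ none
      second := fun p => ρ (some p)
      second_injective := fun p q h => Option.some_injective _ (hρ h)
      fresh_tbox := fun φ hφ => Set.disjoint_left.2 fun r hr =>
        hfresh r (Or.inl (Set.mem_biUnion hφ hr))
      fresh_concept := fun p => Set.disjoint_left.2 fun r hr =>
        hfresh r (Or.inr (Or.inr (Or.inl (Set.mem_iUnion.2 ⟨p, hr⟩))))
      fresh_abox := fun r x y h =>
        hfresh r (Or.inr (Or.inl (Set.mem_biUnion h rfl)))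
      fresh_witness := fun p r x y h =>
        hfresh r (Or.inr (Or.inr (Or.inr (Set.mem_iUnion.2 ⟨p, Set.mem_biUnion h rfl⟩)))) }
  obtain ⟨J, μ, hJ, hJ'⟩ := hT.disjunctionData hA S
  exact ⟨J, μ, hJ, fun p hp => hJ' ⟨p, hp⟩⟩

/-! ### Unraveling tolerant TBoxes are materializable -/

/-- Compactness: each finite set of non-certain queries is refuted in one model, and an ultraproduct
over the finite sets of queries refutes all of them. -/
theorem UnravelingTolerant.materializable_eliq {T : TBox} (hT : UnravelingTolerant T) :
    Materializable .ELIQ T := by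
  classical
  intro A hA _ hc
  let G : Set (Concept × IndName) :=
    {p | p.1.IsELI ∧ p.2 ∈ A.Ind ∧ ¬CertainConcept T A p.1 p.2}
  have h1 : ∀ F : Finset (Concept × IndName), ∃ (I : Interp) (κ : IndName → I.dom),
      IsModel T A I κ ∧ ∀ p ∈ (F : Set (Concept × IndName)) ∩ G, κ p.2 ∉ I.ext p.1 := fun F =>
    hT.exists_isModel_forall_notMem hA hc _ (F.finite_toSet.inter_of_left G) fun p hp => hp.2
  choose I κ hI hG using h1
  have hmod := isModel_ultraproduct
    (U := (Ultrafilter.of atTop : Ultrafilter (Finset (Concept × IndName)))) (A := A) hI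
    fun φ hφ => Eventually.of_forall fun _ => hφ
  refine ⟨_, _, hmod, fun C a hC ha => ⟨fun h => ?_, fun h => h _ _ hmod⟩⟩
  by_contra hcert
  have hev : ∀ᶠ F in ((Ultrafilter.of atTop : Ultrafilter (Finset (Concept × IndName))) :
      Filter (Finset (Concept × IndName))), (C, a) ∈ F := by
    refine Ultrafilter.of_le atTop ?_
    filter_upwards [eventually_ge_atTop {(C, a)}] with F hF
    exact hF (Finset.mem_singleton_self _)
  obtain ⟨F, h1, h2⟩ := ((Interp.ultraMk_mem_ext.1 h).and hev).exists
  exact hG F (C, a) ⟨h2, hC, ha, hcert⟩ h1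

/-! ### From ELIQs to positive existential queries -/

/-- Homomorphisms preserve positive existential queries. -/
theorem Interp.SatQuery.map {I J : Interp} {f : I.dom → J.dom}
    (hconcept : ∀ A d, d ∈ I.concept A → f d ∈ J.concept A)
    (hrole : ∀ r d e, I.role r d e → J.role r (f d) (f e)) {q : PEQuery} {π : Var → I.dom}
    (h : I.SatQuery q π) : J.SatQuery q fun v => f (π v) := by
  induction q generalizing π with
  | top => trivial
  | conceptAtom A v => exact hconcept A _ h
  | roleAtom r v w => exact hrole r _ _ h
  | and p q ihp ihq => exact ⟨ihp h.1, ihq h.2⟩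
  | or p q ihp ihq => exact h.elim (fun h => Or.inl (ihp h)) fun h => Or.inr (ihq h)
  | ex v q ih =>
    obtain ⟨d, hd⟩ := h
    refine ⟨f d, ?_⟩
    have h1 : Function.update (fun w => f (π w)) v (f d) = fun w => f (Function.update π v d w) := by
      funext w
      by_cases hw : w = v
      · subst hw
        simp
      · simp [hw]
    rw [h1]
    exact ih hd

theorem Interp.satQuery_congr {I : Interp} {q : PEQuery} {π ρ : Var → I.dom}
    (h : Set.EqOn π ρ q.freeVars) : I.SatQuery q π ↔ I.SatQuery q ρ := by
  induction q generalizing π ρ with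
  | top => exact Iff.rfl
  | conceptAtom A v =>
    change π v ∈ _ ↔ ρ v ∈ _
    rw [h (show v ∈ ({v} : Set Var) from rfl)]
  | roleAtom r v w =>
    change I.role r (π v) (π w) ↔ I.role r (ρ v) (ρ w)
    rw [h (show v ∈ ({v, w} : Set Var) from Or.inl rfl),
      h (show w ∈ ({v, w} : Set Var) from Or.inr rfl)]
  | and p q ihp ihq =>
    exact and_congr (ihp fun v hv => h (Or.inl hv)) (ihq fun v hv => h (Or.inr hv))
  | or p q ihp ihq =>
    exact or_congr (ihp fun v hv => h (Or.inl hv)) (ihq fun v hv => h (Or.inr hv))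
  | ex v q ih =>
    refine exists_congr fun d => ih fun w hw => ?_
    by_cases hwv : w = v
    · subst hwv
      simp
    · simpa [hwv] using h ⟨hw, hwv⟩

namespace Placement

variable {N : Type} {B : ABox N} {I : Interp} (P : Placement N B I)

/-- Extending a map on the individuals to the forest such that all `ELI`-concepts are preserved. -/
noncomputable def extend {K : Interp} (μ : N → K.dom) : Forest N I.dom → K.dom
  | .root a => μ a
  | .child p r d =>
    have := K.dom_nonempty
    Classical.epsilon fun e => K.roleExt r (extend μ p) e ∧
      ∀ C : Concept, C.IsELI → d ∈ I.ext C → e ∈ K.ext C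

variable {J : Interp} {μ : N → J.natPower.dom}

/-- The ELI-concepts true at `d` are closed under finite conjunction, and `∃ r` of each such
conjunction holds at the parent, hence at its image. Saturation of the ultrapower provides one
successor realizing all of them, so the choice in `extend` succeeds. -/
theorem exists_extend {p : Forest N I.dom} {r : Role} {d : I.dom}
    (hp : ∀ C : Concept, C.IsELI → p.pt P.h ∈ I.ext C → extend μ p ∈ J.natPower.ext C)
    (hd : I.roleExt r (p.pt P.h) d) : J.natPower.roleExt r (extend μ p) (extend μ (.child p r d)) ∧
      ∀ C : Concept, C.IsELI → d ∈ I.ext C → extend μ (.child p r d) ∈ J.natPower.ext C := by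
  obtain ⟨e, he, he'⟩ := J.exists_succ_natPower (extend μ p) r {C | C.IsELI ∧ d ∈ I.ext C}
    fun l hl => hp (.ex r (.conj l)) (Concept.isELI_conj fun C hC => (hl C hC).1)
      ⟨d, hd, Interp.mem_ext_conj.2 fun C hC => (hl C hC).2⟩
  have h : ∃ e, J.natPower.roleExt r (extend μ p) e ∧
      ∀ C : Concept, C.IsELI → d ∈ I.ext C → e ∈ J.natPower.ext C :=
    ⟨e, he, fun C hC hd => he' C ⟨hC, hd⟩⟩
  exact Classical.epsilon_spec h

theorem extend_mem_ext
    (hμ : ∀ a, ∀ C : Concept, C.IsELI → P.h a ∈ I.ext C → μ a ∈ J.natPower.ext C)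
    {p : Forest N I.dom} (hp : P.Valid p) :
    ∀ C : Concept, C.IsELI → p.pt P.h ∈ I.ext C → extend μ p ∈ J.natPower.ext C := by
  induction p with
  | root a => exact hμ a
  | child p r d ih => exact (P.exists_extend (ih hp.1) hp.2.1).2

/-- Forests have homomorphisms into ultrapowers that satisfy the same `ELI`-queries at the
individuals. -/
theorem satQuery_extend [Nonempty N]
    (hμ : ∀ a, ∀ C : Concept, C.IsELI → P.h a ∈ I.ext C → μ a ∈ J.natPower.ext C)
    (hB : ∀ r a b, Assertion.role r a b ∈ B → J.natPower.role r (μ a) (μ b))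
    {q : PEQuery} {π : Var → P.forest.dom} (h : P.forest.SatQuery q π) :
    J.natPower.SatQuery q fun v => extend μ (π v).1 := by
  refine h.map (f := fun x : P.forest.dom => extend μ x.1)
    (fun A x hx => P.extend_mem_ext hμ x.2 (.atom A) trivial hx) ?_
  rintro r ⟨x, hx⟩ ⟨y, hy⟩ (⟨a, b, hab, h1, h2⟩ | ⟨d, hd⟩ | ⟨d, hd⟩)
  · obtain rfl : x = .root a := h1
    obtain rfl : y = .root b := h2
    exact hB r a b hab
  · obtain rfl : y = .child x (.name r) d := hd
    exact (P.exists_extend (P.extend_mem_ext hμ hx) hy.2.1).1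
  · obtain rfl : x = .child y (.inverse r) d := hd
    exact (P.exists_extend (P.extend_mem_ext hμ hy) hx.2.1).1

end Placement

/-- Outside its core `A`, the forest is made of trees, so agreement on ELIQs suffices to build a
homomorphism into an ultrapower of an arbitrary model `J`, node by node. Łoś's theorem then brings
the query back to `J`. -/
theorem Materializable.peq_of_eliq {T : TBox} (h : Materializable .ELIQ T) :
    Materializable .PEQ T := by
  classical
  intro A hfin hne hc
  obtain ⟨I, ι, hI, hI'⟩ := h A hfin hne hc
  obtain ⟨a₀, ha₀⟩ := ABox.ind_nonempty hne
  -- The forest has a root for every name, and preservation of ELI-concepts is required at all of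
  -- them; names outside `A` copy `a₀`.
  let t : IndName → IndName := fun a => if a ∈ A.Ind then a else a₀
  have ht : ∀ a, t a ∈ A.Ind := by
    intro a
    by_cases ha : a ∈ A.Ind
    · simp [t, ha]
    · simpa [t, ha] using ha₀
  have ht' : ∀ a ∈ A.Ind, t a = a := fun a ha => if_pos ha
  let P : Placement IndName A I :=
    { h := fun a => ι (t a)
      e := fun _ _ b => ι (t b)
      concept := by
        intro B a ha
        rw [ht' a ⟨_, ha, rfl⟩]
        exact hI.abox _ ha
      edge := by
        intro a R b hab
        obtain ⟨h1, h2⟩ := ABox.mem_ind_of_hasRole hab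
        rw [ht' a h1, ht' b h2]
        exact Interp.roleExt_of_isModel hI hab
      inj := by
        intro a R b b' hb hb' heq
        have h1 := (ABox.mem_ind_of_hasRole hb).2
        have h2 := (ABox.mem_ind_of_hasRole hb').2
        rw [ht' b h1, ht' b' h2] at heq
        exact hI.standardNames h1 h2 heq }
  have hmod := P.isModel_forest_of_eq hI.tbox fun _ _ _ => rfl
  refine ⟨_, _, hmod, fun q a ha => ⟨fun hq J κ hJ => ?_, fun hq => hq _ _ hmod⟩⟩
  have h1 := P.satQuery_extend (J := J) (μ := fun b => Interp.ultraMk _ _ fun _ => κ (t b))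
    (fun b C hC hb => Interp.ultraMk_mem_ext.2 (Eventually.of_forall fun _ =>
      (hI' C _ hC (ht b)).1 hb J κ hJ))
    (fun r b c hbc => Interp.ultraMk_role.2 (Eventually.of_forall fun _ => by
      rw [ht' b ⟨_, hbc, Or.inl rfl⟩, ht' c ⟨_, hbc, Or.inr rfl⟩]
      exact hJ.abox _ hbc)) hq
  obtain ⟨n, hn⟩ := (Interp.ultraproduct_satQuery (U := natUltrafilter) (I := fun _ => J)
    (π := fun v _ => κ (t (a v)))).1 h1 |>.exists
  refine (Interp.satQuery_congr fun v hv => ?_).1 hn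
  rw [ht' _ (ha v hv)]

theorem UnravelingTolerant.materializable {T : TBox} (hT : UnravelingTolerant T)
    (Q : QueryLanguage) : Materializable Q T := by
  have h := hT.materializable_eliq
  cases Q with
  | PEQ => exact h.peq_of_eliq
  | CQ => exact h.peq_of_eliq.cq_of_peq
  | ELIQ => exact h

theorem Materializable.eliq {T : TBox} {Q : QueryLanguage} (h : Materializable Q T) :
    Materializable .ELIQ T := by
  cases Q with
  | PEQ => exact h.cq_of_peq.eliq_of_cq
  | CQ => exact h.eliq_of_cq
  | ELIQ => exact h

end ALCFI

/-- For `ALCFI`-TBoxes of depth one, materializability (for any of the query languages PEQ, CQ,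
ELIQ) and unraveling tolerance coincide. -/
theorem mainTheorem7 (T : ALCFI.TBox) (hT : T.DepthOne) (Q : ALCFI.QueryLanguage) :
    ALCFI.Materializable Q T ↔ ALCFI.UnravelingTolerant T :=
  ⟨fun h => ALCFI.UnravelingTolerant.of_materializable hT h.eliq, fun h => h.materializable Q⟩
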